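/- Let $\mathbb D=\{z\in\mathbb C:|z|<1\}$, let $\mathbf D$ be its closure, $\mathbb T=\partial\mathbb D$, and let the cone algebra $A_{co}\subseteq C(\mathbf D,\mathbb C)$ be the uniformly closed (unital) subalgebra generated by the functions $z$ and $|z|$. For $r>0$ let $A(r\mathbf D)$ be the algebra of continuous functions on $\{|z|\le r\}$ that are holomorphic in $\{|z|<r\}$; for compact $X\subseteq\mathbb C$ let $P(X)$ be the uniform closure in $C(X,\mathbb C)$ of the polynomials in $z$. For $R>0$ and $|z|<R$ let $$P_R[f](z)=\frac1{2\pi}\int_0^{2\pi}\frac{R^2-|z|^2}{|Re^{it}-z|^2}\,f(Re^{it})\,dt,\qquad P=P_1,$$ and let $f_r(z)=f(rz)$. For a unital commutative Banach algebra $A$, $M(A)$ is the set of nonzero multiplicative linear functionals with the weak-$*$ topology, and $\widehat A\subseteq C(M(A),\mathbb C)$ is the algebra of its Gelfand transforms. Let $K=\{(z,t)\in\mathbb C\times\mathbb R:|z|\le t\le 1\}$. Then: 1. $A(\mathbf D)\subseteq A_{co}\subseteq C(\mathbf D,\mathbb C)$. 2. $A_{co}|_{\mathbb T}=A(\mathbf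 D)|_{\mathbb T}=P(\mathbb T)$. 3. $A_{co}|_{r\mathbb T}=P(r\mathbb T)$ for every $0<r<1$. 4. $M(A_{co})$ is homeomorphic to the cone $\{(x,y,t)\in\mathbb R^3:\sqrt{x^2+y^2}\le t,\ 0\le t\le1\}$, a set of (Hausdorff) dimension $3$, which is identified with $K$. 5. $M(A_{co})=\{\delta_0\}\cup\{\psi_{r,a}:0<r\le1,\ |a|\le r\}$, where $\delta_0$ is evaluation at $0$, $\psi_{r,a}=\delta_a$ is evaluation at $a$ if $|a|=r$, and $\psi_{r,a}(f)=P[(f_r)|_{\mathbb T}](a/r)=P_r[f|_{r\mathbb T}](a)$ for $f\in A_{co}$ if $|a|<r$. The map $(a,r)\mapsto\psi_{r,a}$ (with $(0,0)\mapsto\delta_0$) is a homeomorphism of $K$ onto $M(A_{co})$, by which $M(A_{co})$ is identified with $K$ in parts 6 and 8. 6. As an algebra of functions on $K$, $\widehat{A_{co}}$ is the uniform closure on $K$ of the polynomials $p(z,t)$, $p\in\mathbb C[z,t]$, and it equals $\{f\in C(K,\mathbb C): f(\cdot,r)\in A(r\mathbf D)\text{ for all }0<r\le1\}$. 7. $A_{co}$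 is inverse-closed on $\mathbf D$ (every $f\in A_{co}$ with $|f|\ge\delta>0$ on $\mathbf D$ is invertible in $A_{co}$); that is, it satisfies (C1); but it does not satisfy (Cn) for any $n\ge2$. Here (Cn) says that the $n$-tuples $(f_1,\dots,f_n)\in A_{co}^n$ for which there are $r_1,\dots,r_n\in A_{co}$ with $\sum_j r_jf_j=1$ are exactly those without a common zero on $\mathbf D$. 8. The Shilov boundary of $A_{co}$, i.e. the smallest closed subset of $M(A_{co})=K$ on which every $|\widehat f|$, $f\in A_{co}$, attains its maximum over $M(A_{co})$, is the outer surface $S=\{(z,r)\in\mathbb C\times\mathbb R:0\le r\le1,\ |z|=r\}$ of $K$; $S$ is the boundary of $K$ without $\{(z,1):|z|<1\}$. The Bear--Shilov boundary of $A_{co}$ on $\mathbf D$, i.e. the smallest closed subset of $\mathbf D$ on which every $|f|$, $f\in A_{co}$, attains its maximum over $\mathbf D$, is $\mathbf D$ itself. Explicitly, the following functions belong to $A_{co}$ and attain their maximum modulus at $a$ and at no other point of $\mathbf D$: - for $a=0$: $\frac1{1+|z|}$ and $1-|z|$ (both with value $1$ at $a$); - for $0<|a|\le1$: $z\mapsto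 a+z\,e^{-|z|/|a|}$; - for $0<|a|\le1$: the function equal to $\bigl(1+\frac z{|z|}e^{-i\arg a}\bigr)\frac{p(|z|)}2$ for $z\ne0$ and to $0$ at $z=0$ (with value $1$ at $a$), for every continuous $p:[0,1]\to[0,\infty)$ with $p(x)\le Cx$ for some constant $C$, $p(|a|)=1$ and $p(x)<1$ for $x\ne|a|$; such $p$ exist. -/

import Mathlib

open WeakDual Metric

/-! ### General notions for algebras of continuous functions -/

/-- The invertible `n`-tuples `U_n(A)`. -/
def invertibleTuples {X : Type*} [TopologicalSpace X] (A : Subalgebra ℂ C(X, ℂ)) (n : ℕ) :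
    Set (Fin n → A) :=
  {f | ∃ r : Fin n → A, ∑ j, r j * f j = 1}

/-- The zero set `Z_X(f)`. -/
def zeroSet {X : Type*} [TopologicalSpace X] (f : C(X, ℂ)) : Set X :=
  {x | f x = 0}

/-- `A` is inverse-closed on `X`: every `f ∈ A` with `|f| ≥ δ > 0` on `X` is invertible in `A`. -/
def IsInverseClosed {X : Type*} [TopologicalSpace X] (A : Subalgebra ℂ C(X, ℂ)) : Prop :=
  ∀ f : A, (∃ δ : ℝ, 0 < δ ∧ ∀ x, δ ≤ ‖(f : C(X, ℂ)) x‖) → IsUnit f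

/-- The corona condition (Cn): an `n`-tuple in `A` is invertible exactly when the functions have
no common zero on `X`. -/
def CoronaCondition {X : Type*} [TopologicalSpace X] (A : Subalgebra ℂ C(X, ℂ)) (n : ℕ) : Prop :=
  invertibleTuples A n = {f | ⋂ j, zeroSet (f j : C(X, ℂ)) = ∅}

/-- `E` is a closed boundary for the family `L` of continuous functions on `X`: `E` is closed and
every `f ∈ L` attains on `E` the maximum of `|f|` over `X`. -/
def IsClosedBoundary {X : Type*} [TopologicalSpace X] (L : Set C(X, ℂ)) (E : Set X) : Prop :=
  IsClosed E ∧ ∀ f ∈ L, ∃ y ∈ E, ∀ x, ‖f x‖ ≤ ‖f y‖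

/-- `E` is the Bear--Shilov boundary of `L` on `X`: the smallest closed boundary. -/
def IsBearShilovBoundary {X : Type*} [TopologicalSpace X] (L : Set C(X, ℂ)) (E : Set X) : Prop :=
  IsLeast {F | IsClosedBoundary L F} E

/-- `E` is the Shilov boundary of the algebra `A`: the smallest closed boundary of the algebra of
Gelfand transforms on the spectrum (character space) of `A`. -/
def IsShilovBoundary {X : Type*} [TopologicalSpace X] [CompactSpace X]
    (A : Subalgebra ℂ C(X, ℂ)) (E : Set (characterSpace ℂ A)) : Prop :=
  IsBearShilovBoundary (Set.range (gelfandTransform ℂ A)) E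

/-- `f` takes its maximum modulus at `a` and only there. -/
def PeaksAt {X : Type*} [TopologicalSpace X] (f : C(X, ℂ)) (a : X) : Prop :=
  ∀ x, x ≠ a → ‖f x‖ < ‖f a‖

/-! ### Disks, circles, polynomials, the disk algebra -/

instance closedBallComplexCompactSpace (r : ℝ) : CompactSpace (closedBall (0 : ℂ) r) :=
  isCompact_iff_compactSpace.mp (isCompact_closedBall 0 r)

/-- The closed unit disk `𝐃`. -/
abbrev ClosedDisk : Type := closedBall (0 : ℂ) 1

/-- `A(r𝐃)`: the continuous functions on the closed disk of radius `r` that are holomorphic in the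
open disk of radius `r`. -/
def diskAlgebra (r : ℝ) : Set C(closedBall (0 : ℂ) r, ℂ) :=
  {f | ∃ F : ℂ → ℂ, DifferentiableOn ℂ F (ball 0 r) ∧
    ∀ z : closedBall (0 : ℂ) r, (z : ℂ) ∈ ball (0 : ℂ) r → f z = F z}

/-- `P(X)`: the closure in `C(X, ℂ)` of the polynomials in `z`; used for compact `X ⊆ ℂ`, where the
topology of `C(X, ℂ)` is that of uniform convergence. -/
def polyClosure (X : Set ℂ) : Set C(X, ℂ) :=
  closure (polynomialFunctions X : Set C(X, ℂ))

theorem sphere_subset_closedDisk {r : ℝ} (hr : r ≤ 1) :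
    sphere (0 : ℂ) r ⊆ closedBall (0 : ℂ) 1 :=
  sphere_subset_closedBall.trans (closedBall_subset_closedBall hr)

/-- `L|_{r𝕋}`: the restrictions to the circle `r𝕋` of the functions in `L ⊆ C(𝐃, ℂ)`. -/
def restrictToCircle (L : Set C(ClosedDisk, ℂ)) {r : ℝ} (hr : r ≤ 1) :
    Set C(sphere (0 : ℂ) r, ℂ) :=
  (fun f : C(ClosedDisk, ℂ) => f.comp (ContinuousMap.inclusion (sphere_subset_closedDisk hr))) '' L

/-! ### The cone algebra -/

/-- The coordinate function `z` on `𝐃`. -/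
def zFun : C(ClosedDisk, ℂ) := ⟨fun z => (z : ℂ), by fun_prop⟩

/-- The function `|z|` on `𝐃`. -/
noncomputable def absFun : C(ClosedDisk, ℂ) := ⟨fun z => ((‖(z : ℂ)‖ : ℝ) : ℂ), by fun_prop⟩

/-- The cone algebra: the uniformly closed subalgebra of `C(𝐃, ℂ)` generated by `z` and `|z|`. -/
noncomputable def coneAlgebra : Subalgebra ℂ C(ClosedDisk, ℂ) :=
  (Algebra.adjoin ℂ {zFun, absFun}).topologicalClosure

/-- The spectrum `M(A_co)`: the nonzero multiplicative linear functionals, with the weak-*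
topology. -/
abbrev ConeSpectrum : Type := characterSpace ℂ coneAlgebra

/-! ### The solid cone -/

/-- The solid cone `K = {(z, t) : |z| ≤ t ≤ 1}` in `ℂ × ℝ`. -/
def solidCone : Set (ℂ × ℝ) := {p | ‖p.1‖ ≤ p.2 ∧ p.2 ≤ 1}

/-- The solid cone as a subset of `ℝ³`. -/
def solidCone₃ : Set (EuclideanSpace ℝ (Fin 3)) :=
  {v | √(v 0 ^ 2 + v 1 ^ 2) ≤ v 2 ∧ 0 ≤ v 2 ∧ v 2 ≤ 1}

/-- The outer (lateral) surface `S = {(z, r) : 0 ≤ r ≤ 1, |z| = r}` of the cone. -/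
def coneSurface : Set (ℂ × ℝ) := {p | 0 ≤ p.2 ∧ p.2 ≤ 1 ∧ ‖p.1‖ = p.2}

/-- The inclusion `z ↦ (z, r)` of the closed disk of radius `r` as a horizontal slice of `K`. -/
def coneSlice {r : ℝ} (hr : r ≤ 1) : C(closedBall (0 : ℂ) r, solidCone) :=
  ⟨fun z => ⟨((z : ℂ), r), mem_closedBall_zero_iff.mp z.2, hr⟩, by fun_prop⟩

/-- The polynomials `p(z, t)` as continuous functions on `K`. -/
def conePolynomials : Set C(solidCone, ℂ) :=
  {g | ∃ p : MvPolynomial (Fin 2) ℂ, ∀ x : solidCone,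
    g x = MvPolynomial.eval ![(x : ℂ × ℝ).1, (((x : ℂ × ℝ).2 : ℝ) : ℂ)] p}

/-- The algebra `𝒜` of the continuous functions on `K` that belong to `A(r𝐃)` on the horizontal
slice at height `r`, for every `0 < r ≤ 1`. -/
def sliceHolomorphic : Set C(solidCone, ℂ) :=
  {g | ∀ (r : ℝ) (_ : 0 < r) (h₁ : r ≤ 1), g.comp (coneSlice h₁) ∈ diskAlgebra r}

/-! ### Poisson integrals and the characters -/

/-- The value of `f ∈ C(𝐃, ℂ)` at a point of the plane (zero outside `𝐃`, where it is not used). -/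
noncomputable def diskEval (f : C(ClosedDisk, ℂ)) (w : ℂ) : ℂ :=
  open Classical in if h : w ∈ closedBall (0 : ℂ) 1 then f ⟨w, h⟩ else 0

/-- The Poisson integral
`P_R[f](z) = (1/2π) ∫₀^{2π} (R² - |z|²) / |R e^{it} - z|² * f(R e^{it}) dt`. -/
noncomputable def poissonIntegral (R : ℝ) (f : ℂ → ℂ) (z : ℂ) : ℂ :=
  (1 / (2 * Real.pi) : ℝ) • ∫ t in (0 : ℝ)..2 * Real.pi,
    ((R ^ 2 - ‖z‖ ^ 2) / ‖circleMap 0 R t - z‖ ^ 2 : ℝ) • f (circleMap 0 R t)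

/-- The functional `ψ_{r,a}`: evaluation at `a` if `|a| = r`, and `f ↦ P_r[f|_{r𝕋}](a)` otherwise;
for `r = 0`, `a = 0` this is evaluation at `0`. -/
noncomputable def coneFunctional (r : ℝ) (a : ℂ) (f : C(ClosedDisk, ℂ)) : ℂ :=
  open Classical in if ‖a‖ = r then diskEval f a else poissonIntegral r (diskEval f) a

/-- The Gelfand transforms of the elements of `A_co`, transported to functions on `K` along a
homeomorphism from `K` onto the spectrum. -/
noncomputable def gelfandOnCone (Φ : solidCone ≃ₜ ConeSpectrum) : Set C(solidCone, ℂ) :=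
  Set.range fun f : coneAlgebra => (gelfandTransform ℂ coneAlgebra f).comp
    (Φ : C(solidCone, ConeSpectrum))

/-! ### Peak functions -/

/-- A nonnegative continuous function `p` on `[0,1]` with `p(x) ≤ C x`, peaking at `ρ` with value
`1`. -/
def IsRadialPeak (p : ℝ → ℝ) (ρ : ℝ) : Prop :=
  ContinuousOn p (Set.Icc 0 1) ∧ (∃ C : ℝ, ∀ x ∈ Set.Icc (0 : ℝ) 1, p x ≤ C * x) ∧ p ρ = 1 ∧
    ∀ x ∈ Set.Icc (0 : ℝ) 1, x ≠ ρ → 0 ≤ p x ∧ p x < 1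

/-- The function `(1 + (z/|z|) e^{-i arg a}) p(|z|)/2` for `z ≠ 0`, and `0` at `z = 0`. -/
noncomputable def peakFormula (p : ℝ → ℝ) (a z : ℂ) : ℂ :=
  open Classical in
    if z = 0 then 0
    else (1 + z / (‖z‖ : ℂ) * Complex.exp (-(Complex.arg a : ℂ) * Complex.I)) *
      ((p ‖z‖ : ℝ) / 2 : ℂ)

/-! Everything is moved to the solid cone `K`, where the closed algebra generated by the coordinates
`z` and `t` (`polyCone`) is easy to understand. The lateral surface is the graph of `|z|` over the
disk, and restriction to it turns `z, t` into `z, |z|`. The lateral circle at each height bounds a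
slice on which the functions are holomorphic, so by the maximum principle the restriction is
isometric; its image is therefore closed and equals `coneAlgebra` (`image_restrictLateral`).

On `K` the algebra consists of all continuous functions holomorphic on slices
(`polyCone_eq_sliceHolomorphic`): approximate each slice by a polynomial in `z` and glue with a
partition of unity in `t`, whose members lie in the algebra by Weierstrass. Zero-free elements thus
have inverses in the algebra, so an element killed by a character has a zero on `K`. Applied to a
few test functions, this puts `(φ z, φ t)` in `K`, and `φ` is evaluation there
(`algHom_polyCone_eq_eval`). Holomorphy on slices turns these evaluations into Poisson integrals.

A function bounded away from zero on the lateral surface has no zero in `K`, since the heights of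
zero-free slices form a nonempty clopen subset of `[0,1]` (`ne_zero_of_forall_lateral`); this is
inverse-closedness. For two or more functions the corona condition fails, because common zeros may
lie inside `K`. The boundaries follow from the maximum principle together with a function peaking,
over all of `K`, at each lateral point (`exists_peak`). -/

/-! ### The disk algebra and polynomial approximation -/

theorem mem_diskAlgebra_iff {r : ℝ} (hr : 0 < r) {f : C(closedBall (0 : ℂ) r, ℂ)} :
    f ∈ diskAlgebra r ↔
      ∃ G : ℂ → ℂ, DiffContOnCl ℂ G (ball 0 r) ∧ ∀ z : closedBall (0 : ℂ) r, f z = G z := by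
  classical
  constructor
  · rintro ⟨F, hF, hfF⟩
    let G : ℂ → ℂ := fun z => if h : z ∈ closedBall (0 : ℂ) r then f ⟨z, h⟩ else 0
    have hG : ∀ z : closedBall (0 : ℂ) r, f z = G z := fun z => by simp only [G, dif_pos z.2]
    refine ⟨G, ⟨hF.congr fun z hz => ?_, ?_⟩, hG⟩
    · rw [← hfF ⟨z, ball_subset_closedBall hz⟩ hz, hG]
    · rw [closure_ball _ hr.ne', continuousOn_iff_continuous_domRestrict]
      exact f.continuous.congr hG
  · rintro ⟨G, hG, h⟩
    exact ⟨G, hG.differentiableOn, fun z _ => h z⟩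

/-- Weierstrass: uniform limits of holomorphic functions are holomorphic. -/
theorem isClosed_diskAlgebra (r : ℝ) : IsClosed (diskAlgebra r) := by
  classical
  refine isSeqClosed_iff_isClosed.mp fun u f hu hf => ?_
  choose F hF hFu using fun n => hu n
  let G : ℂ → ℂ := fun z => if h : z ∈ closedBall (0 : ℂ) r then f ⟨z, h⟩ else 0
  have hG : ∀ z : closedBall (0 : ℂ) r, f z = G z := fun z => by simp only [G, dif_pos z.2]
  refine ⟨G, ?_, fun z _ => hG z⟩
  have hlim : TendstoUniformlyOn F G Filter.atTop (ball 0 r) := by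
    rw [ContinuousMap.tendsto_iff_tendstoUniformly] at hf
    rw [Metric.tendstoUniformlyOn_iff]
    intro ε hε
    filter_upwards [Metric.tendstoUniformly_iff.mp hf ε hε] with n hn z hz
    have := hn ⟨z, ball_subset_closedBall hz⟩
    rwa [hFu n _ hz, hG] at this
  exact hlim.tendstoLocallyUniformlyOn.differentiableOn (Filter.Eventually.of_forall hF)
    isOpen_ball

/-- Polynomials are uniformly dense in the functions continuous on a closed disk and holomorphic
inside. -/
theorem DiffContOnCl.exists_polynomial_near {r : ℝ} (hr : 0 < r) {G : ℂ → ℂ}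
    (hG : DiffContOnCl ℂ G (ball 0 r)) {ε : ℝ} (hε : 0 < ε) :
    ∃ p : Polynomial ℂ, ∀ z ∈ closedBall (0 : ℂ) r, ‖G z - p.eval z‖ < ε := by
  have huc : UniformContinuousOn G (closedBall 0 r) :=
    (isCompact_closedBall 0 r).uniformContinuousOn_of_continuous
      (hG.continuousOn_ball)
  obtain ⟨δ, hδ, h⟩ := Metric.uniformContinuousOn_iff.mp huc (ε / 2) (half_pos hε)
  -- The dilate `G (s * z)` is uniformly close to `G`, and its Taylor series converges uniformly on
  -- the closed disk.
  obtain ⟨s, hs0, hs1, hsδ⟩ : ∃ s : ℝ, 0 < s ∧ s < 1 ∧ (1 - s) * r < δ := by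
    have hm : 0 < min (1 / 2) (δ / (2 * r)) := by positivity
    refine ⟨1 - min (1 / 2) (δ / (2 * r)), ?_, by linarith, ?_⟩
    · linarith [min_le_left (1 / 2) (δ / (2 * r))]
    · have : min (1 / 2) (δ / (2 * r)) * r ≤ δ / (2 * r) * r := by
        gcongr; exact min_le_right _ _
      have h2 : δ / (2 * r) * r = δ / 2 := by field_simp
      linarith
  have hsr : s * r < r := by nlinarith
  lift r to NNReal using hr.le
  lift s to NNReal using hs0.le
  have hP := hG.hasFPowerSeriesOnBall (by exact_mod_cast hr)
  -- Uniform convergence is available on open balls only; radius `s' * r` leaves room for the closed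
  -- disk of radius `s * r`.
  obtain ⟨s', hs', hs'1⟩ := exists_between (show s < 1 by exact_mod_cast hs1)
  have hs'r : s' * r < r := by
    have : (0 : NNReal) < r := by exact_mod_cast hr
    calc s' * r < 1 * r := by gcongr
      _ = r := one_mul r
  have hunif := hP.tendstoUniformlyOn (r' := s' * r) (by exact_mod_cast hs'r)
  rw [Metric.tendstoUniformlyOn_iff] at hunif
  obtain ⟨n, hn⟩ := (hunif (ε / 2) (half_pos hε)).exists
  set c := cauchyPowerSeries G 0 r
  refine ⟨∑ k ∈ Finset.range n, Polynomial.C (c.coeff k * (s : ℂ) ^ k) * Polynomial.X ^ k,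
    fun z hz => ?_⟩
  have hz' : ‖z‖ ≤ r := by simpa using hz
  have hsz : ‖(s : ℂ) * z‖ ≤ s * r := by
    rw [norm_mul]; simpa using mul_le_mul_of_nonneg_left hz' s.2
  have h1 := hn (s * z) (by
    rw [mem_ball_zero_iff]
    refine hsz.trans_lt ?_
    have : (0 : ℝ) < r := by exact_mod_cast hr
    push_cast
    gcongr)
  have h2 := h z hz (s * z) (by
      rw [mem_closedBall_zero_iff]; exact hsz.trans hsr.le) (by
    rw [dist_eq_norm, show z - s * z = ((1 - s : ℝ) : ℂ) * z by push_cast; ring, norm_mul,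
      Complex.norm_real, Real.norm_of_nonneg (by linarith)]
    refine lt_of_le_of_lt ?_ hsδ
    exact mul_le_mul_of_nonneg_left hz' (by linarith))
  have h3 : c.partialSum n (s * z) = Polynomial.eval z
      (∑ k ∈ Finset.range n, Polynomial.C (c.coeff k * (s : ℂ) ^ k) * Polynomial.X ^ k) := by
    simp only [FormalMultilinearSeries.partialSum, Polynomial.eval_finsetSum,
      FormalMultilinearSeries.apply_eq_pow_smul_coeff, Polynomial.eval_mul, Polynomial.eval_C,
      Polynomial.eval_pow, Polynomial.eval_X, smul_eq_mul, mul_pow]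
    exact Finset.sum_congr rfl fun k _ => by ring
  rw [zero_add, h3] at h1
  rw [← dist_eq_norm]
  linarith [dist_triangle (G z) (G (s * z)) (Polynomial.eval z
      (∑ k ∈ Finset.range n, Polynomial.C (c.coeff k * (s : ℂ) ^ k) * Polynomial.X ^ k))]

theorem diskAlgebra_eq_polyClosure {r : ℝ} (hr : 0 < r) :
    diskAlgebra r = polyClosure (closedBall (0 : ℂ) r) := by
  apply Set.Subset.antisymm
  · intro f hf
    obtain ⟨G, hG, hfG⟩ := (mem_diskAlgebra_iff hr).mp hf
    refine Metric.mem_closure_iff.mpr fun ε hε => ?_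
    obtain ⟨p, hp⟩ := hG.exists_polynomial_near hr hε
    refine ⟨p.toContinuousMapOn _, ⟨p, trivial, rfl⟩, ?_⟩
    rw [ContinuousMap.dist_lt_iff hε]
    intro z
    rw [dist_eq_norm, hfG]
    exact hp z z.2
  · refine closure_minimal ?_ (isClosed_diskAlgebra r)
    rintro _ ⟨p, -, rfl⟩
    exact ⟨fun z => p.eval z, p.differentiable.differentiableOn, fun z _ => rfl⟩

theorem aeval_mem_of_mem {A : Type*} [CommRing A] [Algebra ℂ A] {B : Subalgebra ℂ A} {x : A}
    (hx : x ∈ B) (p : Polynomial ℂ) : Polynomial.aeval x p ∈ B :=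
  Algebra.adjoin_le (Set.singleton_subset_iff.mpr hx) (Polynomial.aeval_mem_adjoin_singleton ℂ x)

/-! ### The algebra of the solid cone -/

theorem isCompact_solidCone : IsCompact solidCone := by
  refine (((isCompact_closedBall (0 : ℂ) 1).prod (isCompact_Icc (a := (0 : ℝ)) (b := 1)))).of_isClosed_subset
    ?_ ?_
  · exact (isClosed_le (f := fun p : ℂ × ℝ => ‖p.1‖) (g := fun p => p.2) (by fun_prop)
      (by fun_prop)).inter (isClosed_le (f := fun p : ℂ × ℝ => p.2) (g := fun _ => 1)
      (by fun_prop) (by fun_prop))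
  · rintro ⟨z, t⟩ ⟨h1, h2⟩
    have := norm_nonneg z
    exact ⟨by simpa using h1.trans h2, this.trans h1, h2⟩

instance solidConeCompactSpace : CompactSpace solidCone :=
  isCompact_iff_compactSpace.mp isCompact_solidCone

theorem height_nonneg (x : solidCone) : 0 ≤ (x : ℂ × ℝ).2 := (norm_nonneg _).trans x.2.1

/-- The coordinate `z` on the solid cone. -/
def coneZ : C(solidCone, ℂ) := ⟨fun x => (x : ℂ × ℝ).1, by fun_prop⟩

/-- The height `t` on the solid cone. -/
noncomputable def coneT : C(solidCone, ℂ) := ⟨fun x => ((x : ℂ × ℝ).2 : ℂ), by fun_prop⟩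

/-- The uniformly closed algebra generated by the coordinates of the solid cone. -/
noncomputable def polyCone : Subalgebra ℂ C(solidCone, ℂ) :=
  (Algebra.adjoin ℂ {coneZ, coneT}).topologicalClosure

theorem coneZ_mem : coneZ ∈ polyCone :=
  Subalgebra.le_topologicalClosure _ (Algebra.subset_adjoin (by simp))

theorem coneT_mem : coneT ∈ polyCone :=
  Subalgebra.le_topologicalClosure _ (Algebra.subset_adjoin (by simp))

theorem isClosed_polyCone : IsClosed (polyCone : Set C(solidCone, ℂ)) :=
  Subalgebra.isClosed_topologicalClosure _

theorem closure_conePolynomials : closure conePolynomials = (polyCone : Set C(solidCone, ℂ)) := by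
  rw [polyCone, Subalgebra.topologicalClosure_coe]
  congr 1
  have : ({coneZ, coneT} : Set C(solidCone, ℂ)) = Set.range ![coneZ, coneT] := by
    simp [Matrix.range_cons, Set.pair_comm]
  rw [this, Algebra.adjoin_range_eq_range_aeval]
  have key : ∀ (p : MvPolynomial (Fin 2) ℂ) (x : solidCone),
      MvPolynomial.aeval ![coneZ, coneT] p x =
        MvPolynomial.eval ![(x : ℂ × ℝ).1, (((x : ℂ × ℝ).2 : ℝ) : ℂ)] p := by
    intro p x
    induction p using MvPolynomial.induction_on with
    | C a => simp
    | add p q hp hq => simp [hp, hq]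
    | mul_X p i hp =>
      rw [map_mul, map_mul, ContinuousMap.mul_apply, hp]
      fin_cases i <;> simp [coneZ, coneT]
  ext g
  constructor
  · rintro ⟨p, hp⟩
    exact ⟨p, ContinuousMap.ext fun x => by rw [hp x]; exact key p x⟩
  · rintro ⟨p, rfl⟩
    exact ⟨p, fun x => key p x⟩

/-- Working form: the slice functions are defined on `ℂ`, so algebraic operations and the maximum
principle apply directly. -/
theorem mem_sliceHolomorphic_iff {g : C(solidCone, ℂ)} : g ∈ sliceHolomorphic ↔
    ∀ t : ℝ, 0 < t → t ≤ 1 → ∃ G : ℂ → ℂ, DiffContOnCl ℂ G (ball 0 t) ∧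
      ∀ x : solidCone, (x : ℂ × ℝ).2 = t → g x = G (x : ℂ × ℝ).1 := by
  refine forall_congr' fun t => forall_congr' fun ht => forall_congr' fun h1 => ?_
  rw [mem_diskAlgebra_iff ht]
  refine exists_congr fun G => and_congr_right fun _ => ⟨fun h x hx => ?_, fun h z => ?_⟩
  · subst hx
    exact h ⟨(x : ℂ × ℝ).1, mem_closedBall_zero_iff.mpr x.2.1⟩
  · exact h _ rfl

theorem isClosed_sliceHolomorphic : IsClosed sliceHolomorphic := by
  have : sliceHolomorphic = ⋂ (r : ℝ) (_ : 0 < r) (h₁ : r ≤ 1),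
      (fun g : C(solidCone, ℂ) => g.comp (coneSlice h₁)) ⁻¹' diskAlgebra r := by
    ext g; simp [sliceHolomorphic]
  rw [this]
  exact isClosed_iInter fun r => isClosed_iInter fun hr => isClosed_iInter fun h₁ =>
    (isClosed_diskAlgebra r).preimage (ContinuousMap.continuous_precomp _)

theorem mul_mem_sliceHolomorphic {f g : C(solidCone, ℂ)} (hf : f ∈ sliceHolomorphic)
    (hg : g ∈ sliceHolomorphic) : f * g ∈ sliceHolomorphic := by
  rw [mem_sliceHolomorphic_iff] at *
  intro t ht h1
  obtain ⟨F, hF, hfF⟩ := hf t ht h1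
  obtain ⟨G, hG, hgG⟩ := hg t ht h1
  exact ⟨fun z => F z * G z, hF.smul hG, fun x hx => by
    rw [ContinuousMap.mul_apply, hfF x hx, hgG x hx]⟩

theorem add_mem_sliceHolomorphic {f g : C(solidCone, ℂ)} (hf : f ∈ sliceHolomorphic)
    (hg : g ∈ sliceHolomorphic) : f + g ∈ sliceHolomorphic := by
  rw [mem_sliceHolomorphic_iff] at *
  intro t ht h1
  obtain ⟨F, hF, hfF⟩ := hf t ht h1
  obtain ⟨G, hG, hgG⟩ := hg t ht h1
  exact ⟨fun z => F z + G z, hF.add hG, fun x hx => by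
    rw [ContinuousMap.add_apply, hfF x hx, hgG x hx]⟩

theorem mem_sliceHolomorphic_of_height {g : C(solidCone, ℂ)} (h : ℝ → ℂ)
    (hg : ∀ x : solidCone, g x = h (x : ℂ × ℝ).2) : g ∈ sliceHolomorphic :=
  mem_sliceHolomorphic_iff.mpr fun t _ _ => ⟨fun _ => h t, diffContOnCl_const, fun x hx => by
    rw [hg, hx]⟩

theorem polyCone_subset_sliceHolomorphic :
    (polyCone : Set C(solidCone, ℂ)) ⊆ sliceHolomorphic := by
  refine closure_minimal ?_ isClosed_sliceHolomorphic
  intro g hg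
  induction hg using Algebra.adjoin_induction with
  | mem g hg =>
    rcases hg with rfl | rfl
    · exact mem_sliceHolomorphic_iff.mpr fun t _ _ => ⟨id, differentiable_id.diffContOnCl,
        fun x _ => rfl⟩
    · exact mem_sliceHolomorphic_of_height (fun t => (t : ℂ)) fun _ => rfl
  | algebraMap c => exact mem_sliceHolomorphic_of_height (fun _ => c) fun _ => rfl
  | add f g _ _ hf hg => exact add_mem_sliceHolomorphic hf hg
  | mul f g _ _ hf hg => exact mul_mem_sliceHolomorphic hf hg

/-- Real continuous functions of the height belong to the algebra. -/
theorem height_mem_polyCone {g : C(solidCone, ℂ)} (h : C(ℝ, ℝ))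
    (hg : ∀ x : solidCone, g x = h (x : ℂ × ℝ).2) : g ∈ polyCone := by
  rw [← SetLike.mem_coe, ← isClosed_polyCone.closure_eq]
  refine Metric.mem_closure_iff.mpr fun ε hε => ?_
  obtain ⟨p, hp⟩ := exists_polynomial_near_of_continuousOn 0 1 h h.continuous.continuousOn ε hε
  refine ⟨Polynomial.aeval coneT (p.map (algebraMap ℝ ℂ)),
    aeval_mem_of_mem coneT_mem _, ?_⟩
  rw [ContinuousMap.dist_lt_iff hε]
  intro x
  have := hp (x : ℂ × ℝ).2 ⟨height_nonneg x, x.2.2⟩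
  have h2 : Polynomial.eval (((x : ℂ × ℝ).2 : ℝ) : ℂ) (p.map (algebraMap ℝ ℂ)) =
      ((p.eval (x : ℂ × ℝ).2 : ℝ) : ℂ) := by
    rw [Polynomial.eval_map_algebraMap]
    exact Polynomial.aeval_algebraMap_apply_eq_algebraMap_eval _ _
  rw [Polynomial.aeval_continuousMap_apply, hg, dist_comm, dist_eq_norm]
  change ‖Polynomial.eval (((x : ℂ × ℝ).2 : ℝ) : ℂ) _ - _‖ < ε
  rw [h2, ← Complex.ofReal_sub, Complex.norm_real]
  exact this

/-- All real heights are allowed so that a polynomial can be chosen for each `t`; slices outside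
`[0,1]` are empty and the slice at `0` is the apex alone. -/
theorem exists_polynomial_near_on_slice {g : C(solidCone, ℂ)} (hg : g ∈ sliceHolomorphic)
    {ε : ℝ} (hε : 0 < ε) (t : ℝ) : ∃ p : Polynomial ℂ, ∀ x : solidCone, (x : ℂ × ℝ).2 = t →
      ‖g x - p.eval (x : ℂ × ℝ).1‖ < ε := by
  by_cases h1 : t ≤ 1
  swap
  · exact ⟨0, fun x hx => absurd (hx ▸ x.2.2) h1⟩
  rcases lt_trichotomy t 0 with ht | rfl | ht
  · exact ⟨0, fun x hx => absurd (hx ▸ height_nonneg x) ht.not_ge⟩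
  · refine ⟨Polynomial.C (g ⟨(0, 0), by simp [solidCone]⟩), fun x hx => ?_⟩
    have : x = ⟨(0, 0), by simp [solidCone]⟩ := by
      have h := x.2.1
      rw [hx, norm_le_zero_iff] at h
      exact Subtype.ext (Prod.ext h hx)
    rw [this]
    simpa using hε
  · obtain ⟨G, hG, hgG⟩ := mem_sliceHolomorphic_iff.mp hg t ht h1
    obtain ⟨p, hp⟩ := hG.exists_polynomial_near ht hε
    refine ⟨p, fun x hx => ?_⟩
    rw [hgG x hx]
    exact hp _ (by rw [mem_closedBall_zero_iff, ← hx]; exact x.2.1)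

/-- Localization in the height: a polynomial good on one slice is good on nearby slices, and
compactness of `[0,1]` leaves finitely many polynomials to glue. -/
theorem sliceHolomorphic_subset_polyCone :
    sliceHolomorphic ⊆ (polyCone : Set C(solidCone, ℂ)) := by
  intro g hg
  rw [← isClosed_polyCone.closure_eq]
  refine Metric.mem_closure_iff.mpr fun ε hε => ?_
  choose p hp using fun t => exists_polynomial_near_on_slice hg (half_pos hε) t
  let P : ℝ → C(solidCone, ℂ) := fun t => Polynomial.aeval coneZ (p t)
  have hPx : ∀ t x, P t x = (p t).eval (x : ℂ × ℝ).1 := fun t x =>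
    Polynomial.aeval_continuousMap_apply _ _ _
  -- The heights at which `P t` fails to approximate `g`: a compact projection that misses `t`, so
  -- the complements form an open cover.
  let bad : ℝ → Set ℝ := fun t => (fun x : solidCone => (x : ℂ × ℝ).2) '' {x | ε / 2 ≤ ‖g x - P t x‖}
  have hbad : ∀ t, IsClosed (bad t) := fun t =>
    ((isClosed_le (by fun_prop) (by fun_prop)).isCompact.image (by fun_prop)).isClosed
  have hcover : Set.Icc (0 : ℝ) 1 ⊆ ⋃ t, (bad t)ᶜ := fun t _ => Set.mem_iUnion.mpr ⟨t, by
    rintro ⟨x, hx, hxt⟩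
    have := hp t x hxt
    rw [← hPx] at this
    exact absurd hx this.not_ge⟩
  obtain ⟨s, hs⟩ := isCompact_Icc.elim_finite_subcover _ (fun t => (hbad t).isOpen_compl) hcover
  obtain ⟨f, hf⟩ := PartitionOfUnity.exists_isSubordinate (isClosed_Icc (a := (0 : ℝ)) (b := 1))
    (fun i : s => (bad i)ᶜ) (fun i => (hbad i).isOpen_compl) (by
      intro t ht
      simpa using hs ht)
  let χ : s → C(solidCone, ℂ) := fun i => ⟨fun x => (f i (x : ℂ × ℝ).2 : ℂ), by fun_prop⟩
  refine ⟨∑ i, χ i * P i, Subalgebra.sum_mem _ fun i _ => polyCone.mul_mem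
    (height_mem_polyCone (f i) fun _ => rfl) (aeval_mem_of_mem coneZ_mem _), ?_⟩
  refine lt_of_le_of_lt ((ContinuousMap.dist_le (half_pos hε).le).mpr fun x => ?_) (half_lt_self hε)
  set t := (x : ℂ × ℝ).2
  have hsum : ∑ i, f i t = 1 := by
    have := f.sum_eq_one (x := t) ⟨height_nonneg x, x.2.2⟩
    rwa [finsum_eq_sum_of_fintype] at this
  have hsumC : ∑ i, (f i t : ℂ) = 1 := by rw [← Complex.ofReal_sum, hsum, Complex.ofReal_one]
  have hdiff : g x - (∑ i, χ i * P i) x = ∑ i, (f i t : ℂ) * (g x - P i x) := by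
    simp only [mul_sub, Finset.sum_sub_distrib, ← Finset.sum_mul, hsumC, one_mul]
    simp [χ, t]
  rw [dist_eq_norm, hdiff]
  calc ‖∑ i, (f i t : ℂ) * (g x - P i x)‖ ≤ ∑ i, f i t * (ε / 2) := by
        refine norm_sum_le_of_le _ fun i _ => ?_
        rw [norm_mul, Complex.norm_real, Real.norm_of_nonneg (f.nonneg i t)]
        by_cases h0 : f i t = 0
        · simp [h0]
        -- A nonzero weight puts the height in the support of `f i`, hence outside `bad i`.
        · refine mul_le_mul_of_nonneg_left ?_ (f.nonneg i t)
          by_contra hlt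
          exact hf i (subset_closure h0) ⟨x, (not_le.mp hlt).le, rfl⟩
    _ = ε / 2 := by rw [← Finset.sum_mul, hsum, one_mul]

theorem polyCone_eq_sliceHolomorphic : (polyCone : Set C(solidCone, ℂ)) = sliceHolomorphic :=
  polyCone_subset_sliceHolomorphic.antisymm sliceHolomorphic_subset_polyCone

theorem mem_polyCone_iff {g : C(solidCone, ℂ)} : g ∈ polyCone ↔ g ∈ sliceHolomorphic := by
  rw [← polyCone_eq_sliceHolomorphic, SetLike.mem_coe]

/-- The maximum principle on the horizontal slices. -/
theorem norm_le_of_forall_lateral {g : C(solidCone, ℂ)} (hg : g ∈ sliceHolomorphic) (x : solidCone)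
    {C : ℝ} (hC : ∀ y : solidCone, (y : ℂ × ℝ).2 = (x : ℂ × ℝ).2 →
      ‖(y : ℂ × ℝ).1‖ = (y : ℂ × ℝ).2 → ‖g y‖ ≤ C) : ‖g x‖ ≤ C := by
  rcases (height_nonneg x).eq_or_lt with h0 | h0
  · refine hC x rfl (le_antisymm x.2.1 ?_)
    rw [← h0]; exact norm_nonneg _
  · obtain ⟨G, hG, hgG⟩ := mem_sliceHolomorphic_iff.mp hg _ h0 x.2.2
    rw [hgG x rfl]
    refine Complex.norm_le_of_forall_mem_frontier_norm_le isBounded_ball hG (fun z hz => ?_) ?_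
    · rw [frontier_ball _ h0.ne', mem_sphere_zero_iff_norm] at hz
      have := hC ⟨(z, (x : ℂ × ℝ).2), hz.le, x.2.2⟩ rfl hz
      exact hgG ⟨(z, (x : ℂ × ℝ).2), hz.le, x.2.2⟩ rfl ▸ this
    · rw [closure_ball _ h0.ne', mem_closedBall_zero_iff]
      exact x.2.1

theorem exists_inverse_mem_sliceHolomorphic {g : C(solidCone, ℂ)} (hg : g ∈ sliceHolomorphic)
    (h0 : ∀ x, g x ≠ 0) : ∃ k ∈ sliceHolomorphic, g * k = 1 := by
  refine ⟨⟨fun x => (g x)⁻¹, g.continuous.inv₀ h0⟩, ?_, ContinuousMap.ext fun x =>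
    mul_inv_cancel₀ (h0 x)⟩
  rw [mem_sliceHolomorphic_iff] at *
  intro t ht h1
  obtain ⟨G, hG, hgG⟩ := hg t ht h1
  refine ⟨G⁻¹, hG.inv fun z hz => ?_, fun x hx => by simp [hgG x hx]⟩
  rw [closure_ball _ ht.ne', mem_closedBall_zero_iff] at hz
  have := h0 ⟨(z, t), hz, h1⟩
  rwa [hgG _ rfl] at this

/-! ### The lateral surface and the cone algebra -/

/-- The lateral point of the cone over a point of the disk. -/
noncomputable def lateral : C(ClosedDisk, solidCone) :=
  ⟨fun z => ⟨((z : ℂ), ‖(z : ℂ)‖), le_rfl, mem_closedBall_zero_iff.mp z.2⟩, by fun_prop⟩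

theorem lateral_of_norm_eq {x : solidCone} (hx : ‖(x : ℂ × ℝ).1‖ = (x : ℂ × ℝ).2) :
    lateral ⟨(x : ℂ × ℝ).1, mem_closedBall_zero_iff.mpr (hx.le.trans x.2.2)⟩ = x :=
  Subtype.ext (Prod.ext rfl hx)

/-- Each slice is bounded by its lateral circle, so the maximum principle applies. -/
theorem norm_comp_lateral {g : C(solidCone, ℂ)} (hg : g ∈ polyCone) :
    ‖g.comp lateral‖ = ‖g‖ := by
  apply le_antisymm
  · exact (ContinuousMap.norm_le _ (norm_nonneg _)).mpr fun z => g.norm_coe_le_norm _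
  · refine (ContinuousMap.norm_le _ (norm_nonneg _)).mpr fun x =>
      norm_le_of_forall_lateral (polyCone_subset_sliceHolomorphic hg) x fun y _ hy => ?_
    rw [← lateral_of_norm_eq hy]
    exact (g.comp lateral).norm_coe_le_norm _

/-- Restriction to the lateral surface. -/
noncomputable def restrictLateral : C(solidCone, ℂ) →ₐ[ℂ] C(ClosedDisk, ℂ) :=
  ContinuousMap.compRightAlgHom ℂ ℂ lateral

instance completeSpace_polyCone : CompleteSpace polyCone :=
  isClosed_polyCone.completeSpace_coe

instance completeSpace_coneAlgebra : CompleteSpace coneAlgebra :=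
  (Subalgebra.isClosed_topologicalClosure _).completeSpace_coe

/-- Generators go to generators, and an isometric image of a complete algebra is closed; hence every
element of the closure extends to `K`. -/
theorem image_restrictLateral :
    polyCone.map restrictLateral = coneAlgebra := by
  apply le_antisymm
  · rintro _ ⟨g, hg, rfl⟩
    have hcont : Continuous restrictLateral := ContinuousMap.continuous_precomp _
    refine map_mem_closure hcont hg fun p hp => ?_
    change restrictLateral p ∈ Algebra.adjoin ℂ {zFun, absFun}
    induction hp using Algebra.adjoin_induction with
    | mem g hg =>
      rcases hg with rfl | rfl
      · exact Algebra.subset_adjoin (Or.inl rfl)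
      · exact Algebra.subset_adjoin (Or.inr rfl)
    | algebraMap c => rw [AlgHom.commutes]; exact Subalgebra.algebraMap_mem _ _
    | add f g _ _ hf hg => rw [map_add]; exact Subalgebra.add_mem _ hf hg
    | mul f g _ _ hf hg => rw [map_mul]; exact Subalgebra.mul_mem _ hf hg
  · refine Subalgebra.topologicalClosure_minimal (Algebra.adjoin_le ?_) ?_
    · rintro _ (rfl | rfl)
      · exact ⟨coneZ, coneZ_mem, rfl⟩
      · exact ⟨coneT, coneT_mem, rfl⟩
    · have hiso : Isometry (restrictLateral.comp polyCone.val) :=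
        AddMonoidHomClass.isometry_of_norm _ fun g => norm_comp_lateral g.2
      have := hiso.isClosedEmbedding.isClosed_range
      rw [Subalgebra.coe_map]
      rwa [AlgHom.coe_comp, Set.range_comp, Subalgebra.coe_val, Subtype.range_coe] at this

theorem mem_coneAlgebra_iff {f : C(ClosedDisk, ℂ)} :
    f ∈ coneAlgebra ↔ ∃ g ∈ sliceHolomorphic, g.comp lateral = f := by
  rw [← image_restrictLateral, Subalgebra.mem_map]
  simp only [mem_polyCone_iff]
  rfl

/-- Restriction to the lateral surface identifies the algebra of the solid cone with the cone
algebra. -/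
noncomputable def lateralEquiv : polyCone ≃ₐ[ℂ] coneAlgebra :=
  AlgEquiv.ofBijective
    ((restrictLateral.comp polyCone.val).codRestrict coneAlgebra fun g => by
      rw [← image_restrictLateral]; exact ⟨g, g.2, rfl⟩) <| by
    constructor
    · rw [injective_iff_map_eq_zero]
      intro g hg
      have h : (g : C(solidCone, ℂ)).comp lateral = 0 := congrArg Subtype.val hg
      have := norm_comp_lateral g.2
      rw [h, norm_zero, eq_comm, norm_eq_zero] at this
      exact Subtype.ext this
    · rintro ⟨f, hf⟩
      rw [← image_restrictLateral] at hf
      obtain ⟨g, hg, rfl⟩ := hf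
      exact ⟨⟨g, hg⟩, rfl⟩

/-- The continuous extension of a function in the cone algebra to the solid cone. -/
noncomputable def coneExtension (f : coneAlgebra) : C(solidCone, ℂ) := (lateralEquiv.symm f).1

theorem coneExtension_mem (f : coneAlgebra) : coneExtension f ∈ sliceHolomorphic :=
  polyCone_subset_sliceHolomorphic (lateralEquiv.symm f).2

theorem coneExtension_comp_lateral (f : coneAlgebra) :
    (coneExtension f).comp lateral = (f : C(ClosedDisk, ℂ)) :=
  congrArg Subtype.val (lateralEquiv.apply_symm_apply f)

theorem coneExtension_lateral (f : coneAlgebra) (z : ClosedDisk) :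
    coneExtension f (lateral z) = (f : C(ClosedDisk, ℂ)) z :=
  DFunLike.congr_fun (coneExtension_comp_lateral f) z

theorem coneExtension_lateralEquiv (g : polyCone) : coneExtension (lateralEquiv g) = g := by
  rw [coneExtension, AlgEquiv.symm_apply_apply]

theorem range_coneExtension : Set.range coneExtension = (polyCone : Set C(solidCone, ℂ)) := by
  ext g
  constructor
  · rintro ⟨f, rfl⟩
    exact (lateralEquiv.symm f).2
  · exact fun hg => ⟨lateralEquiv ⟨g, hg⟩, coneExtension_lateralEquiv _⟩

/-! ### The characters -/

/-- Evaluation of the extension at a point of the solid cone. -/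
noncomputable def coneEvalHom (x : solidCone) : coneAlgebra →ₐ[ℂ] ℂ :=
  ((ContinuousMap.evalAlgHom ℂ ℂ x).comp polyCone.val).comp lateralEquiv.symm.toAlgHom

/-- The character of the cone algebra given by a point of the solid cone. -/
noncomputable def coneCharacter (x : solidCone) : ConeSpectrum :=
  CharacterSpace.equivAlgHom.symm (coneEvalHom x)

theorem coneCharacter_apply (x : solidCone) (f : coneAlgebra) :
    coneCharacter x f = coneExtension f x := rfl

theorem continuous_coneCharacter : Continuous coneCharacter := by
  refine Continuous.subtype_mk (WeakDual.continuous_of_continuous_eval fun f => ?_) _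
  exact (coneExtension f).continuous

theorem injective_coneCharacter : Function.Injective coneCharacter := by
  intro x y hxy
  have h : ∀ g ∈ polyCone, g x = g y := fun g hg => by
    have := DFunLike.congr_fun hxy (lateralEquiv ⟨g, hg⟩)
    rwa [coneCharacter_apply, coneCharacter_apply, coneExtension_lateralEquiv] at this
  exact Subtype.ext (Prod.ext (h _ coneZ_mem) (Complex.ofReal_injective (h _ coneT_mem)))

/-- A zero-free element is invertible in the algebra, and no character kills a unit. -/
theorem exists_zero_of_apply_eq_zero (φ : polyCone →ₐ[ℂ] ℂ) {g : polyCone} (hg : φ g = 0) :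
    ∃ x, (g : C(solidCone, ℂ)) x = 0 := by
  by_contra! h
  obtain ⟨k, hk, hgk⟩ := exists_inverse_mem_sliceHolomorphic
    (polyCone_subset_sliceHolomorphic g.2) h
  have : g * ⟨k, mem_polyCone_iff.mpr hk⟩ = 1 := Subtype.ext hgk
  have := congrArg φ this
  rw [map_mul, hg, zero_mul, map_one] at this
  exact zero_ne_one this

theorem algHom_polyCone_eq_eval (φ : polyCone →ₐ[ℂ] ℂ) :
    ∃ x : solidCone, ∀ g : polyCone, φ g = (g : C(solidCone, ℂ)) x := by
  set Z : polyCone := ⟨coneZ, coneZ_mem⟩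
  set T : polyCone := ⟨coneT, coneT_mem⟩
  set a := φ Z
  -- A zero of `T - φ T` shows that `φ T` is the height of a point of `K`, hence real and in
  -- `[0,1]`.
  obtain ⟨y, hy⟩ := exists_zero_of_apply_eq_zero φ
    (g := T - algebraMap ℂ polyCone (φ T)) (by simp)
  set τ : ℝ := (y : ℂ × ℝ).2
  have hτ : φ T = τ := (sub_eq_zero.mp hy).symm
  have haτ : ‖a‖ ≤ τ := by
    by_contra! hlt
    have hτ0 : 0 ≤ τ := height_nonneg y
    have ha : 0 < ‖a‖ := hτ0.trans_lt hlt
    have haC : (‖a‖ : ℂ) ≠ 0 := by exact_mod_cast ha.ne'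
    -- The test function is killed by `φ`, but at a zero of height `t` one would have `|z| = |‖a‖ +
    -- t - τ| > t`, which is impossible in `K`.
    obtain ⟨x, hx⟩ := exists_zero_of_apply_eq_zero φ
      (g := (Z - algebraMap ℂ polyCone a) - algebraMap ℂ polyCone (a / ‖a‖) *
        (T - algebraMap ℂ polyCone τ)) (by simp [hτ, a])
    have hx' : (x : ℂ × ℝ).1 - a - a / ‖a‖ * (((x : ℂ × ℝ).2 : ℂ) - τ) = 0 := hx
    have hz : (x : ℂ × ℝ).1 = a / ‖a‖ * ((‖a‖ + ((x : ℂ × ℝ).2 - τ) : ℝ) : ℂ) := by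
      have h1 : a / ‖a‖ * ‖a‖ = a := div_mul_cancel₀ _ haC
      push_cast
      linear_combination hx' - h1
    have hn := x.2.1
    have hx0 := height_nonneg x
    rw [hz, norm_mul, norm_div, Complex.norm_real, Complex.norm_real, norm_norm,
      div_self ha.ne', one_mul, Real.norm_eq_abs] at hn
    have := le_abs_self (‖a‖ + ((x : ℂ × ℝ).2 - τ))
    linarith
  refine ⟨⟨(a, τ), haτ, y.2.2⟩, fun g => ?_⟩
  -- Characters of a Banach algebra are automatically continuous, so agreement on the dense
  -- polynomials suffices.
  have hcont : Continuous φ := (φ.toContinuousLinearMap).continuous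
  obtain ⟨u, hu, hlim⟩ := mem_closure_iff_seq_limit.mp g.2
  have hu' : ∀ n, u n ∈ polyCone := fun n => Subalgebra.le_topologicalClosure _ (hu n)
  have h1 : Filter.Tendsto (fun n => (⟨u n, hu' n⟩ : polyCone)) Filter.atTop (nhds g) :=
    tendsto_subtype_rng.mpr hlim
  have h2 := (hcont.tendsto g).comp h1
  have h3 := ((continuous_eval_const (F := C(solidCone, ℂ))
    (⟨(a, τ), haτ, y.2.2⟩ : solidCone)).tendsto _).comp hlim
  refine tendsto_nhds_unique h2 (h3.congr fun n => ?_)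
  have key : ∀ p (hp : p ∈ Algebra.adjoin ℂ {coneZ, coneT}),
      p (⟨(a, τ), haτ, y.2.2⟩ : solidCone) = φ ⟨p, Subalgebra.le_topologicalClosure _ hp⟩ := by
    intro p hp
    induction hp using Algebra.adjoin_induction with
    | mem g hg =>
      rcases hg with rfl | rfl
      · rfl
      · exact hτ.symm
    | algebraMap c => exact (φ.commutes c).symm
    | add f g hf hg hf' hg' =>
      rw [ContinuousMap.add_apply, hf', hg', ← map_add]; rfl
    | mul f g hf hg hf' hg' =>
      rw [ContinuousMap.mul_apply, hf', hg', ← map_mul]; rfl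
  exact key _ (hu n)

theorem surjective_coneCharacter : Function.Surjective coneCharacter := by
  intro φ
  obtain ⟨x, hx⟩ := algHom_polyCone_eq_eval
    ((CharacterSpace.toAlgHom φ).comp lateralEquiv.toAlgHom)
  refine ⟨x, DFunLike.ext _ _ fun f => ?_⟩
  have := hx (lateralEquiv.symm f)
  rw [coneCharacter_apply, coneExtension, ← this]
  change φ (lateralEquiv (lateralEquiv.symm f)) = φ f
  rw [AlgEquiv.apply_symm_apply]

/-- The homeomorphism from the solid cone onto the spectrum of the cone algebra. -/
noncomputable def coneHomeo : solidCone ≃ₜ ConeSpectrum :=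
  Continuous.homeoOfEquivCompactToT2
    (f := Equiv.ofBijective coneCharacter ⟨injective_coneCharacter, surjective_coneCharacter⟩)
    continuous_coneCharacter

theorem coneHomeo_apply (x : solidCone) (f : coneAlgebra) :
    coneHomeo x f = coneExtension f x := rfl

/-! ### Poisson integrals and the list of characters -/

theorem poissonIntegral_congr {R : ℝ} {f g : ℂ → ℂ} (hR : 0 ≤ R)
    (h : ∀ z : ℂ, ‖z‖ = R → f z = g z) (a : ℂ) :
    poissonIntegral R f a = poissonIntegral R g a := by
  simp only [poissonIntegral]
  congr 1
  refine intervalIntegral.integral_congr fun t _ => ?_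
  rw [h (circleMap 0 R t) (by simp [abs_of_nonneg hR])]

theorem DiffContOnCl.poissonIntegral_eq {R : ℝ} {G : ℂ → ℂ} (hG : DiffContOnCl ℂ G (ball 0 R))
    {a : ℂ} (ha : ‖a‖ < R) : poissonIntegral R G a = G a := by
  have h := hG.circleAverage_poissonKernel_smul (mem_ball_zero_iff.mpr ha)
  have hR : 0 < R := (norm_nonneg a).trans_lt ha
  rw [← h, Real.circleAverage, poissonIntegral, one_div]
  congr 1
  refine intervalIntegral.integral_congr fun t _ => ?_
  simp [poissonKernel_def, abs_of_pos hR]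

/-- At an inner point of a slice, the Poisson formula recovers the holomorphic slice function from
its lateral values, which are those of `f`. -/
theorem coneFunctional_eq_coneExtension (x : solidCone) (f : coneAlgebra) :
    coneFunctional (x : ℂ × ℝ).2 (x : ℂ × ℝ).1 f = coneExtension f x := by
  rw [coneFunctional]
  split_ifs with h
  · rw [diskEval, dif_pos (mem_closedBall_zero_iff.mpr (h.le.trans x.2.2)),
      ← coneExtension_lateral, lateral_of_norm_eq h]
  · have hlt : ‖(x : ℂ × ℝ).1‖ < (x : ℂ × ℝ).2 := lt_of_le_of_ne x.2.1 h
    have h0 := (norm_nonneg _).trans_lt hlt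
    obtain ⟨G, hG, hgG⟩ := mem_sliceHolomorphic_iff.mp (coneExtension_mem f) _ h0 x.2.2
    rw [hgG x rfl, ← hG.poissonIntegral_eq hlt]
    refine poissonIntegral_congr h0.le (fun z hz => ?_) _
    have hz1 : z ∈ closedBall (0 : ℂ) 1 := mem_closedBall_zero_iff.mpr (hz.le.trans x.2.2)
    rw [diskEval, dif_pos hz1, ← coneExtension_lateral]
    exact hgG _ hz

theorem poissonIntegral_one_div {r : ℝ} (hr : 0 < r) (f : ℂ → ℂ) (a : ℂ) :
    poissonIntegral 1 (fun z => f (r * z)) (a / r) = poissonIntegral r f a := by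
  simp only [poissonIntegral]
  congr 1
  refine intervalIntegral.integral_congr fun t _ => ?_
  have hrC : (r : ℂ) ≠ 0 := by exact_mod_cast hr.ne'
  have h1 : (r : ℂ) * circleMap 0 1 t = circleMap 0 r t := by simp [circleMap]
  have h2 : circleMap 0 1 t - a / r = (circleMap 0 r t - a) / r := by
    rw [← h1]; field_simp
  simp only [h1, h2]
  congr 1
  rw [norm_div, norm_div, Complex.norm_real, Real.norm_of_nonneg hr.le]
  -- If `a` is the circle point itself, both kernels are `0` by the division convention.
  by_cases h : ‖circleMap 0 r t - a‖ = 0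
  · simp [h]
  · field_simp

theorem range_characters :
    Set.range (fun (φ : ConeSpectrum) (f : coneAlgebra) => φ f) =
      {fun f : coneAlgebra => diskEval f 0} ∪
        {ψ | ∃ (r : ℝ) (a : ℂ), 0 < r ∧ r ≤ 1 ∧ ‖a‖ ≤ r ∧
          ψ = fun f : coneAlgebra => coneFunctional r a f} := by
  have key : ∀ x : solidCone, (fun f : coneAlgebra => coneHomeo x f) =
      fun f : coneAlgebra => coneFunctional (x : ℂ × ℝ).2 (x : ℂ × ℝ).1 f := fun x =>
    funext fun f => by rw [coneHomeo_apply, coneFunctional_eq_coneExtension]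
  have hzero : (fun f : coneAlgebra => coneFunctional 0 0 (f : C(ClosedDisk, ℂ))) =
      fun f : coneAlgebra => diskEval f 0 := funext fun f => by
    rw [coneFunctional, if_pos norm_zero]
  ext ψ
  constructor
  · rintro ⟨φ, rfl⟩
    obtain ⟨x, rfl⟩ := coneHomeo.surjective φ
    rcases (height_nonneg x).eq_or_lt with h0 | h0
    · left
      have hz : (x : ℂ × ℝ).1 = 0 := norm_le_zero_iff.mp (h0 ▸ x.2.1)
      refine (key x).trans ?_
      rw [← h0, hz]
      exact hzero
    · exact Or.inr ⟨_, _, h0, x.2.2, x.2.1, key x⟩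
  · rintro (rfl | ⟨r, a, h0, h1, ha, rfl⟩)
    · exact ⟨coneHomeo ⟨(0, 0), by simp [solidCone]⟩, (key _).trans hzero⟩
    · exact ⟨coneHomeo ⟨(a, r), ha, h1⟩, key _⟩

/-! ### Restrictions to circles -/

theorem aeval_zFun (p : Polynomial ℂ) :
    Polynomial.aeval zFun p = p.toContinuousMapOn (closedBall 0 1) :=
  ContinuousMap.ext fun z => Polynomial.aeval_continuousMap_apply p zFun z

theorem zFun_mem : zFun ∈ coneAlgebra :=
  Subalgebra.le_topologicalClosure _ (Algebra.subset_adjoin (by simp))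

theorem isClosed_coneAlgebra : IsClosed (coneAlgebra : Set C(ClosedDisk, ℂ)) :=
  Subalgebra.isClosed_topologicalClosure _

theorem diskAlgebra_subset_coneAlgebra :
    diskAlgebra 1 ⊆ (coneAlgebra : Set C(ClosedDisk, ℂ)) := by
  rw [diskAlgebra_eq_polyClosure one_pos]
  refine closure_minimal ?_ isClosed_coneAlgebra
  rintro _ ⟨p, -, rfl⟩
  change p.toContinuousMapOn _ ∈ coneAlgebra
  rw [← aeval_zFun]
  exact aeval_mem_of_mem zFun_mem p

theorem Polynomial.norm_eval_le_of_forall_sphere (p : Polynomial ℂ) {r C : ℝ} (hr : 0 < r)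
    (hC : ∀ z : ℂ, ‖z‖ = r → ‖p.eval z‖ ≤ C) {w : ℂ} (hw : ‖w‖ ≤ r) : ‖p.eval w‖ ≤ C := by
  refine Complex.norm_le_of_forall_mem_frontier_norm_le (U := ball 0 r) isBounded_ball
    p.differentiable.diffContOnCl (fun z hz => hC z ?_) ?_
  · rwa [frontier_ball _ hr.ne', mem_sphere_zero_iff_norm] at hz
  · rwa [closure_ball _ hr.ne', mem_closedBall_zero_iff]

/-- Polynomials `q n` converging on the circle are composed with `w`. Since `|w| ≤ r`, the maximum
principle makes `q n ∘ w` uniformly Cauchy on the whole disk; the limit lies in `E` and restricts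
correctly because `w = z` on the circle. -/
theorem polyClosure_sphere_subset_restrictToCircle {r : ℝ} (hr : 0 < r) (hr1 : r ≤ 1)
    {E : Set C(ClosedDisk, ℂ)} (hE : IsClosed E) (w : C(ClosedDisk, ℂ)) (hw : ∀ z, ‖w z‖ ≤ r)
    (hwz : ∀ z : ClosedDisk, ‖(z : ℂ)‖ = r → w z = z)
    (hwE : ∀ p : Polynomial ℂ, Polynomial.aeval w p ∈ E) :
    polyClosure (sphere (0 : ℂ) r) ⊆ restrictToCircle E hr1 := by
  intro h hh
  obtain ⟨u, hu, hlim⟩ := mem_closure_iff_seq_limit.mp hh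
  choose q _ hqu using hu
  have hqu' : ∀ n (z : sphere (0 : ℂ) r), u n z = (q n).eval (z : ℂ) := fun n z => by
    rw [← hqu]; rfl
  have hres : ∀ n, (Polynomial.aeval w (q n)).comp
      (ContinuousMap.inclusion (sphere_subset_closedDisk hr1)) = u n := fun n => by
    ext z
    rw [ContinuousMap.comp_apply, Polynomial.aeval_continuousMap_apply, hqu', hwz]
    · rfl
    · exact mem_sphere_zero_iff_norm.mp z.2
  have hcauchy : CauchySeq fun n => Polynomial.aeval w (q n) := by
    rw [Metric.cauchySeq_iff]
    intro ε hε
    obtain ⟨N, hN⟩ := Metric.cauchySeq_iff.mp hlim.cauchySeq ε hε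
    refine ⟨N, fun m hm n hn => lt_of_le_of_lt ?_ (hN m hm n hn)⟩
    rw [ContinuousMap.dist_le dist_nonneg]
    intro z
    rw [Polynomial.aeval_continuousMap_apply, Polynomial.aeval_continuousMap_apply, dist_eq_norm,
      ← Polynomial.eval_sub]
    refine Polynomial.norm_eval_le_of_forall_sphere _ hr (fun y hy => ?_) (hw z)
    have := ContinuousMap.dist_apply_le_dist (f := u m) (g := u n)
      ⟨y, mem_sphere_zero_iff_norm.mpr hy⟩
    rwa [hqu', hqu', dist_eq_norm, ← Polynomial.eval_sub] at this
  obtain ⟨v, hv⟩ := cauchySeq_tendsto_of_complete hcauchy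
  refine ⟨v, hE.mem_of_tendsto hv (Filter.Eventually.of_forall fun n => hwE _), ?_⟩
  have h1 := ((ContinuousMap.continuous_precomp (Z := ℂ)
    (ContinuousMap.inclusion (sphere_subset_closedDisk hr1))).tendsto v).comp hv
  exact tendsto_nhds_unique h1 (hlim.congr fun n => (hres n).symm)

/-- A function in the cone algebra that is the identity on the disk of radius `r` and retracts
the unit disk onto it. -/
theorem exists_retraction_mem_coneAlgebra {r : ℝ} (hr : 0 < r) :
    ∃ w ∈ coneAlgebra, (∀ z, ‖w z‖ ≤ r) ∧ ∀ z : ClosedDisk, ‖(z : ℂ)‖ = r → w z = z := by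
  have hmax : ∀ t : ℝ, 0 < max t r := fun t => lt_max_of_lt_right hr
  -- The retraction is `z * r / max |z| r`: the coordinate times a function of the height.
  let k : C(solidCone, ℂ) := ⟨fun x => ((r / max (x : ℂ × ℝ).2 r : ℝ) : ℂ), by
    have : ∀ x : solidCone, max (x : ℂ × ℝ).2 r ≠ 0 := fun x => (hmax _).ne'
    fun_prop (disch := assumption)⟩
  have hk : k ∈ sliceHolomorphic := mem_sliceHolomorphic_of_height
    (fun t => ((r / max t r : ℝ) : ℂ)) fun _ => rfl
  have happ : ∀ z : ClosedDisk, (coneZ * k).comp lateral z =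
      (z : ℂ) * ((r / max ‖(z : ℂ)‖ r : ℝ) : ℂ) := fun z => rfl
  refine ⟨(coneZ * k).comp lateral, mem_coneAlgebra_iff.mpr ⟨_, mul_mem_sliceHolomorphic
    (polyCone_subset_sliceHolomorphic coneZ_mem) hk, rfl⟩, fun z => ?_, fun z hz => ?_⟩
  · rw [happ, norm_mul, Complex.norm_real,
      Real.norm_of_nonneg (div_nonneg hr.le (hmax _).le), mul_div_assoc', div_le_iff₀ (hmax _),
      mul_comm]
    exact mul_le_mul_of_nonneg_left (le_max_left _ _) hr.le
  · rw [happ, hz, max_self, div_self hr.ne', Complex.ofReal_one, mul_one]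

theorem restrictToCircle_coneAlgebra {r : ℝ} (hr : 0 < r) (hr1 : r ≤ 1) :
    restrictToCircle (coneAlgebra : Set C(ClosedDisk, ℂ)) hr1 = polyClosure (sphere (0 : ℂ) r) := by
  apply Set.Subset.antisymm
  · rintro _ ⟨f, hf, rfl⟩
    obtain ⟨g, hg, rfl⟩ := mem_coneAlgebra_iff.mp hf
    refine Metric.mem_closure_iff.mpr fun ε hε => ?_
    obtain ⟨p, hp⟩ := exists_polynomial_near_on_slice hg hε r
    refine ⟨p.toContinuousMapOn _, ⟨p, trivial, rfl⟩, ?_⟩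
    rw [ContinuousMap.dist_lt_iff hε]
    intro z
    rw [dist_eq_norm]
    exact hp (lateral ⟨z, sphere_subset_closedDisk hr1 z.2⟩) (mem_sphere_zero_iff_norm.mp z.2)
  · obtain ⟨w, hw, hwr, hwz⟩ := exists_retraction_mem_coneAlgebra hr
    exact polyClosure_sphere_subset_restrictToCircle hr hr1 isClosed_coneAlgebra w hwr hwz
      fun p => aeval_mem_of_mem hw p

theorem restrictToCircle_diskAlgebra :
    restrictToCircle (diskAlgebra 1) le_rfl = polyClosure (sphere (0 : ℂ) 1) := by
  apply Set.Subset.antisymm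
  · rw [← restrictToCircle_coneAlgebra one_pos le_rfl]
    exact Set.image_mono diskAlgebra_subset_coneAlgebra
  · refine polyClosure_sphere_subset_restrictToCircle one_pos le_rfl (isClosed_diskAlgebra 1) zFun
      (fun z => mem_closedBall_zero_iff.mp z.2) (fun _ _ => rfl) fun p => ?_
    rw [aeval_zFun, diskAlgebra_eq_polyClosure one_pos]
    exact subset_closure ⟨p, trivial, rfl⟩

/-! ### The geometry of the cone -/

/-- The identification of the two models of the solid cone. -/
noncomputable def solidConeHomeo : solidCone ≃ₜ solidCone₃ :=
  Continuous.homeoOfEquivCompactToT2 (f :=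
    { toFun := fun x => ⟨!₂[(x : ℂ × ℝ).1.re, (x : ℂ × ℝ).1.im, (x : ℂ × ℝ).2], by
        have h := x.2.1
        rw [Complex.norm_eq_sqrt_sq_add_sq] at h
        exact ⟨h, height_nonneg x, x.2.2⟩⟩
      invFun := fun v => ⟨(⟨v.1 0, v.1 1⟩, v.1 2), by
        have h := v.2.1
        refine ⟨?_, v.2.2.2⟩
        rw [Complex.norm_eq_sqrt_sq_add_sq]
        exact h⟩
      left_inv := fun x => rfl
      right_inv := fun v => by
        ext i
        fin_cases i <;> rfl }) <| by
    refine Continuous.subtype_mk ((PiLp.continuous_toLp 2 _).comp (continuous_pi fun i => ?_)) _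
    fin_cases i
    · exact Complex.continuous_re.comp (continuous_fst.comp continuous_subtype_val)
    · exact Complex.continuous_im.comp (continuous_fst.comp continuous_subtype_val)
    · exact continuous_snd.comp continuous_subtype_val

theorem dimH_solidCone₃ : dimH solidCone₃ = 3 := by
  have hopen : IsOpen {v : EuclideanSpace ℝ (Fin 3) | √(v 0 ^ 2 + v 1 ^ 2) < v 2 ∧ v 2 < 1} :=
    (isOpen_lt (f := fun v : EuclideanSpace ℝ (Fin 3) => √(v 0 ^ 2 + v 1 ^ 2))
      (g := fun v => v 2) (by fun_prop) (by fun_prop)).inter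
      (isOpen_lt (f := fun v : EuclideanSpace ℝ (Fin 3) => v 2) (g := fun _ => 1)
      (by fun_prop) (by fun_prop))
  rw [Real.dimH_of_nonempty_interior, finrank_euclideanSpace_fin]
  · norm_num
  · refine ⟨!₂[0, 0, 1 / 2], interior_maximal ?_ hopen ?_⟩
    · rintro v ⟨h1, h2⟩
      exact ⟨h1.le, (Real.sqrt_nonneg _).trans h1.le, h2.le⟩
    · change √((0 : ℝ) ^ 2 + 0 ^ 2) < 1 / 2 ∧ (1 / 2 : ℝ) < 1
      norm_num

theorem coneSurface_eq_frontier_diff :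
    coneSurface = frontier solidCone \ {p : ℂ × ℝ | ‖p.1‖ < 1 ∧ p.2 = 1} := by
  rw [isCompact_solidCone.isClosed.frontier_eq]
  ext ⟨z, t⟩
  constructor
  · rintro ⟨h0, h1, hz⟩
    simp only at h0 h1 hz
    refine ⟨⟨⟨hz.le, h1⟩, fun hint => ?_⟩, fun h => ?_⟩
    · obtain ⟨ε, hε, hball⟩ := Metric.mem_nhds_iff.mp (mem_interior_iff_mem_nhds.mp hint)
      -- Lowering the height of a lateral point leaves `K`.
      have hmem : (z, t - ε / 2) ∈ ball (z, t) ε := by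
        rw [mem_ball, Prod.dist_eq, dist_self, Real.dist_eq, sub_sub_cancel_left, abs_neg,
          abs_of_pos (half_pos hε)]
        exact max_lt hε (half_lt_self hε)
      have : ‖z‖ ≤ t - ε / 2 := (hball hmem).1
      linarith
    · have h1 : ‖z‖ < 1 := h.1
      have h2 : t = 1 := h.2
      linarith
  · rintro ⟨⟨⟨hz, h1⟩, hint⟩, hne⟩
    simp only at hz h1
    refine ⟨(norm_nonneg z).trans hz, h1, ?_⟩
    by_contra hzt
    have hlt : ‖z‖ < t := lt_of_le_of_ne hz hzt
    rcases h1.eq_or_lt with h1 | h1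
    · exact hne ⟨h1 ▸ hlt, h1⟩
    · have hmem : (z, t) ∈ {p : ℂ × ℝ | ‖p.1‖ < p.2 ∧ p.2 < 1} := ⟨hlt, h1⟩
      have hsub : {p : ℂ × ℝ | ‖p.1‖ < p.2 ∧ p.2 < 1} ⊆ solidCone :=
        fun p hp => ⟨hp.1.le, hp.2.le⟩
      refine hint (interior_maximal hsub ?_ hmem)
      exact (isOpen_lt (f := fun p : ℂ × ℝ => ‖p.1‖) (g := fun p => p.2) (by fun_prop)
        (by fun_prop)).inter (isOpen_lt (f := fun p : ℂ × ℝ => p.2) (g := fun _ => 1)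
        (by fun_prop) (by fun_prop))

/-! ### Inverse-closedness and the corona conditions -/

/-- The minimum principle on a horizontal slice without zeros. -/
theorem le_norm_of_forall_lateral {g : C(solidCone, ℂ)} (hg : g ∈ sliceHolomorphic) (x : solidCone)
    {δ : ℝ} (hδ : 0 < δ) (h0 : ∀ y : solidCone, (y : ℂ × ℝ).2 = (x : ℂ × ℝ).2 → g y ≠ 0)
    (hlat : ∀ z, δ ≤ ‖g (lateral z)‖) : δ ≤ ‖g x‖ := by
  rcases (height_nonneg x).eq_or_lt with ht | ht
  · have hx : ‖(x : ℂ × ℝ).1‖ = (x : ℂ × ℝ).2 :=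
      le_antisymm x.2.1 (ht ▸ norm_nonneg _)
    rw [← lateral_of_norm_eq hx]
    exact hlat _
  · obtain ⟨G, hG, hgG⟩ := mem_sliceHolomorphic_iff.mp hg _ ht x.2.2
    have hne : ∀ z ∈ closure (ball (0 : ℂ) (x : ℂ × ℝ).2), G z ≠ 0 := fun z hz => by
      rw [closure_ball _ ht.ne', mem_closedBall_zero_iff] at hz
      have h := h0 ⟨(z, (x : ℂ × ℝ).2), hz, x.2.2⟩ rfl
      have hz' : g ⟨(z, (x : ℂ × ℝ).2), hz, x.2.2⟩ = G z := hgG _ rfl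
      rwa [hz'] at h
    have hxb : (x : ℂ × ℝ).1 ∈ closure (ball (0 : ℂ) (x : ℂ × ℝ).2) := by
      rw [closure_ball _ ht.ne', mem_closedBall_zero_iff]
      exact x.2.1
    -- The maximum principle for `1 / G`.
    have := Complex.norm_le_of_forall_mem_frontier_norm_le (C := δ⁻¹) isBounded_ball (hG.inv hne)
      (fun z hz => ?_) hxb
    · rw [Pi.inv_apply, norm_inv] at this
      rw [hgG x rfl]
      exact (inv_le_inv₀ (norm_pos_iff.mpr (hne _ hxb)) hδ).mp this
    · rw [frontier_ball _ ht.ne', mem_sphere_zero_iff_norm] at hz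
      have hz1 : ‖z‖ ≤ 1 := hz.le.trans x.2.2
      have h := hlat ⟨z, mem_closedBall_zero_iff.mpr hz1⟩
      rw [hgG _ hz] at h
      rw [Pi.inv_apply, norm_inv]
      exact inv_anti₀ hδ h

/-- The parametrization of the solid cone by a cylinder. -/
def coneOfCylinder : C(ClosedDisk × unitInterval, solidCone) :=
  ⟨fun p => ⟨((p.2 : ℝ) * (p.1 : ℂ), p.2), by
    have h1 : ‖(p.1 : ℂ)‖ ≤ 1 := mem_closedBall_zero_iff.mp p.1.2
    refine ⟨?_, p.2.2.2⟩
    rw [norm_mul, Complex.norm_real, Real.norm_of_nonneg p.2.2.1]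
    exact mul_le_of_le_one_right p.2.2.1 h1⟩, by fun_prop⟩

theorem exists_coneOfCylinder (x : solidCone) (t : unitInterval) (ht : (x : ℂ × ℝ).2 = t) :
    ∃ w, coneOfCylinder (w, t) = x := by
  rcases (height_nonneg x).eq_or_lt with h0 | h0
  · refine ⟨⟨0, by simp⟩, Subtype.ext (Prod.ext ?_ ht.symm)⟩
    have : (x : ℂ × ℝ).1 = 0 := norm_le_zero_iff.mp (h0 ▸ x.2.1)
    rw [this]
    exact mul_zero _
  · have hC : ((x : ℂ × ℝ).2 : ℂ) ≠ 0 := by exact_mod_cast h0.ne'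
    refine ⟨⟨(x : ℂ × ℝ).1 / (x : ℂ × ℝ).2, ?_⟩, Subtype.ext (Prod.ext ?_ ht.symm)⟩
    · rw [mem_closedBall_zero_iff, norm_div, Complex.norm_real, Real.norm_of_nonneg h0.le,
        div_le_one h0]
      exact x.2.1
    · change ((t : ℝ) : ℂ) * ((x : ℂ × ℝ).1 / (x : ℂ × ℝ).2) = _
      rw [← ht, mul_div_cancel₀ _ hC]

/-- Connectedness of `[0,1]`: the set `V` of heights whose slice satisfies `|g| ≥ δ` is clopen and
contains `0`, where the slice is the apex. The cylinder gives all slices the same compact fibre. -/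
theorem ne_zero_of_forall_lateral {g : C(solidCone, ℂ)} (hg : g ∈ sliceHolomorphic)
    {δ : ℝ} (hδ : 0 < δ) (hlat : ∀ z, δ ≤ ‖g (lateral z)‖) (x : solidCone) : g x ≠ 0 := by
  let V : Set unitInterval := {t | ∀ w, δ ≤ ‖g (coneOfCylinder (w, t))‖}
  have hV : IsClosed V := by
    simp only [V, Set.ofPred_forall]
    exact isClosed_iInter fun w => isClosed_le (by fun_prop) (by fun_prop)
  -- By the minimum principle a zero-free slice already satisfies the bound `δ`, so `V` is also the
  -- complement of a projected zero set, which is closed.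
  have hVc : V = (Prod.snd '' {p | g (coneOfCylinder p) = 0})ᶜ := by
    ext t
    constructor
    · rintro ht ⟨⟨w, _⟩, hw, rfl⟩
      have := ht w
      rw [Set.mem_ofPred_eq] at hw
      rw [hw, norm_zero] at this
      exact absurd this hδ.not_ge
    · intro ht w
      refine le_norm_of_forall_lateral hg _ hδ (fun y hy hy0 => ht ?_) hlat
      obtain ⟨v, rfl⟩ := exists_coneOfCylinder y t hy
      exact ⟨(v, t), hy0, rfl⟩
  have hV' : IsOpen V := by
    rw [hVc, isOpen_compl_iff]
    exact isClosedMap_snd_of_compactSpace _ (isClosed_eq (by fun_prop) (by fun_prop))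
  have hne : V.Nonempty := ⟨0, fun w => by
    have : coneOfCylinder (w, 0) = lateral ⟨0, by simp⟩ :=
      Subtype.ext (Prod.ext (by simp [coneOfCylinder, lateral]) (by simp [coneOfCylinder, lateral]))
    rw [this]
    exact hlat _⟩
  have huniv := IsClopen.eq_univ ⟨hV, hV'⟩ hne
  obtain ⟨w, hw⟩ := exists_coneOfCylinder x ⟨(x : ℂ × ℝ).2, height_nonneg x, x.2.2⟩ rfl
  have : (⟨(x : ℂ × ℝ).2, height_nonneg x, x.2.2⟩ : unitInterval) ∈ V := huniv ▸ Set.mem_univ _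
  have := this w
  rw [hw] at this
  exact norm_pos_iff.mp (hδ.trans_le this)

theorem isInverseClosed_coneAlgebra : IsInverseClosed coneAlgebra := by
  rintro f ⟨δ, hδ, h⟩
  obtain ⟨k, hk, hgk⟩ := exists_inverse_mem_sliceHolomorphic (coneExtension_mem f)
    (ne_zero_of_forall_lateral (coneExtension_mem f) hδ fun z => by
      rw [coneExtension_lateral]; exact h z)
  refine IsUnit.of_mul_eq_one ⟨k.comp lateral, mem_coneAlgebra_iff.mpr ⟨k, hk, rfl⟩⟩
    (Subtype.ext (ContinuousMap.ext fun z => ?_))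
  have := DFunLike.congr_fun hgk (lateral z)
  rw [ContinuousMap.mul_apply, coneExtension_lateral] at this
  exact this

theorem coronaCondition_one : CoronaCondition coneAlgebra 1 := by
  ext f
  constructor
  · rintro ⟨r, hr⟩
    rw [Set.mem_ofPred_eq, Set.eq_empty_iff_forall_notMem]
    intro z hz
    have h0 : (f 0 : C(ClosedDisk, ℂ)) z = 0 := Set.mem_iInter.mp hz 0
    have h1 := DFunLike.congr_fun (congrArg Subtype.val hr) z
    simp [h0] at h1
  · intro h
    have hne : ∀ z, (f 0 : C(ClosedDisk, ℂ)) z ≠ 0 := fun z hz => by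
      have : z ∈ ⋂ j, zeroSet (f j : C(ClosedDisk, ℂ)) := Set.mem_iInter.mpr fun j => by
        rw [Subsingleton.elim j 0]; exact hz
      rw [Set.mem_ofPred_eq.mp h] at this
      exact this
    have : Nonempty ClosedDisk := ⟨⟨0, by simp⟩⟩
    obtain ⟨z₀, -, hz₀⟩ := isCompact_univ.exists_isMinOn Set.univ_nonempty
      ((f 0 : C(ClosedDisk, ℂ)).continuous.norm.continuousOn)
    obtain ⟨k, hk⟩ := (isInverseClosed_coneAlgebra (f 0)
      ⟨_, norm_pos_iff.mpr (hne z₀), fun z => hz₀ (Set.mem_univ z)⟩).exists_left_inv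
    exact ⟨fun _ => k, by simpa using hk⟩

theorem not_coronaCondition {n : ℕ} (hn : 2 ≤ n) : ¬ CoronaCondition coneAlgebra n := by
  intro h
  -- `z` and `t - 1/2` vanish together only at this point, off the lateral surface: there is no
  -- common zero on the disk, but a character kills both.
  let x : solidCone := ⟨(0, 1 / 2), by norm_num [solidCone]⟩
  let Z : polyCone := ⟨coneZ, coneZ_mem⟩
  let T : polyCone := ⟨coneT, coneT_mem⟩ - algebraMap ℂ polyCone (1 / 2)
  let f : Fin n → coneAlgebra := fun j => lateralEquiv (if (j : ℕ) = 0 then Z else T)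
  have hf : f ∈ {f : Fin n → coneAlgebra | ⋂ j, zeroSet (f j : C(ClosedDisk, ℂ)) = ∅} := by
    rw [Set.mem_ofPred_eq, Set.eq_empty_iff_forall_notMem]
    intro z hz
    rw [Set.mem_iInter] at hz
    have h0 : (z : ℂ) = 0 := hz ⟨0, by omega⟩
    have h1 : ((‖(z : ℂ)‖ : ℝ) : ℂ) - 1 / 2 = 0 := hz ⟨1, by omega⟩
    rw [h0] at h1
    norm_num at h1
  rw [← show invertibleTuples coneAlgebra n = _ from h] at hf
  obtain ⟨r, hr⟩ := hf
  have hzero : ∀ j, coneCharacter x (f j) = 0 := fun j => by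
    rw [coneCharacter_apply, coneExtension_lateralEquiv]
    split_ifs
    · rfl
    · change (((1 / 2 : ℝ) : ℝ) : ℂ) - 1 / 2 = 0
      norm_num
  have := congrArg (coneCharacter x) hr
  rw [map_sum, map_one] at this
  simp [hzero] at this

/-! ### Peak functions and boundaries -/

/-- Strict convexity of the disk, with weights `1/(1+s)` and `s/(1+s)`. -/
theorem norm_add_mul_lt {a z : ℂ} {s : ℝ} (hs : 0 < s) (hz : ‖z‖ ≤ ‖a‖) (hne : z ≠ a) :
    ‖a + z * s‖ < ‖a‖ * (1 + s) := by
  have h1 : 0 < 1 + s := by linarith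
  have := norm_combo_lt_of_ne (a := 1 / (1 + s)) (b := s / (1 + s)) le_rfl hz hne.symm
    (by positivity) (by positivity) (by field_simp)
  have h2 : a + z * s = ((1 + s : ℝ) : ℂ) * ((1 / (1 + s)) • a + (s / (1 + s)) • z) := by
    have : (1 + s : ℂ) ≠ 0 := by exact_mod_cast h1.ne'
    simp only [Complex.real_smul]
    push_cast
    field_simp
  rw [h2, norm_mul, Complex.norm_real, Real.norm_of_nonneg h1.le, mul_comm]
  exact mul_lt_mul_of_pos_right this h1

/-- This is `u + 1 < exp u` at `u = t/ρ - 1 ≠ 0`. -/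
theorem mul_exp_neg_div_lt {ρ t : ℝ} (hρ : 0 < ρ) (hne : t ≠ ρ) :
    t * Real.exp (-(t / ρ)) < ρ * Real.exp (-1) := by
  have h : t / ρ - 1 ≠ 0 := fun h => hne (by field_simp at h; linarith)
  have h1 := Real.add_one_lt_exp h
  rw [sub_add_cancel, div_lt_iff₀ hρ] at h1
  have h2 : Real.exp (t / ρ - 1) * Real.exp (-(t / ρ)) = Real.exp (-1) := by
    rw [← Real.exp_add]; congr 1; ring
  rw [← h2, ← mul_assoc, mul_comm ρ]
  exact mul_lt_mul_of_pos_right h1 (Real.exp_pos _)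

/-- Keeping `t` independent of `|z|` gives a peak over all of `K`. Strictness comes from the radial
factor if `t ≠ |a|`, and from strict convexity if `t = |a|`. -/
theorem exp_peak {a : ℂ} (ha : a ≠ 0) {z : ℂ} {t : ℝ} (hzt : ‖z‖ ≤ t) (hne : z ≠ a ∨ t ≠ ‖a‖) :
    ‖a + z * (Real.exp (-(t / ‖a‖)) : ℂ)‖ < ‖a + a * (Real.exp (-(‖a‖ / ‖a‖)) : ℂ)‖ := by
  have hρ := norm_pos_iff.mpr ha
  have hval : ‖a + a * (Real.exp (-(‖a‖ / ‖a‖)) : ℂ)‖ = ‖a‖ * (1 + Real.exp (-1)) := by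
    rw [div_self hρ.ne', show a + a * (Real.exp (-1) : ℂ) = a * ((1 + Real.exp (-1) : ℝ) : ℂ) by
      push_cast; ring, norm_mul, Complex.norm_real, Real.norm_of_nonneg (by positivity)]
  rw [hval]
  by_cases ht : t = ‖a‖
  · rw [ht, div_self hρ.ne']
    exact norm_add_mul_lt (Real.exp_pos _) (ht ▸ hzt) (hne.resolve_right (not_not.mpr ht))
  · calc ‖a + z * (Real.exp (-(t / ‖a‖)) : ℂ)‖
        ≤ ‖a‖ + ‖z‖ * Real.exp (-(t / ‖a‖)) := by
          refine (norm_add_le _ _).trans_eq ?_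
          rw [norm_mul, Complex.norm_real, Real.norm_of_nonneg (Real.exp_pos _).le]
      _ ≤ ‖a‖ + t * Real.exp (-(t / ‖a‖)) := by gcongr
      _ < ‖a‖ * (1 + Real.exp (-1)) := by linarith [mul_exp_neg_div_lt hρ ht]

theorem exists_exp_peak {a : ClosedDisk} (ha : (a : ℂ) ≠ 0) :
    ∃ g ∈ sliceHolomorphic, (∀ x : solidCone, g x = (a : ℂ) + (x : ℂ × ℝ).1 *
      (Real.exp (-((x : ℂ × ℝ).2 / ‖(a : ℂ)‖)) : ℂ)) ∧ PeaksAt g (lateral a) := by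
  refine ⟨⟨fun x => (a : ℂ) + (x : ℂ × ℝ).1 *
      (Real.exp (-((x : ℂ × ℝ).2 / ‖(a : ℂ)‖)) : ℂ), by fun_prop⟩,
    mem_sliceHolomorphic_iff.mpr fun t _ _ => ⟨fun z => (a : ℂ) + z *
      (Real.exp (-(t / ‖(a : ℂ)‖)) : ℂ), Differentiable.diffContOnCl (by fun_prop),
      fun x hx => by subst hx; rfl⟩, fun _ => rfl, fun x hx => ?_⟩
  refine exp_peak ha x.2.1 ?_
  by_contra! h
  exact hx (Subtype.ext (Prod.ext h.1 h.2))

theorem injective_lateral : Function.Injective lateral := fun _ _ h =>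
  Subtype.ext (congrArg (fun x : solidCone => (x : ℂ × ℝ).1) h)

theorem PeaksAt.comp_lateral {g : C(solidCone, ℂ)} {a : ClosedDisk} (h : PeaksAt g (lateral a)) :
    PeaksAt (g.comp lateral) a := fun _ hz => h _ (injective_lateral.ne hz)

theorem exists_one_sub_peak {a : ClosedDisk} (ha : (a : ℂ) = 0) :
    ∃ g ∈ sliceHolomorphic, (∀ x : solidCone, g x = 1 - ((x : ℂ × ℝ).2 : ℂ)) ∧
      PeaksAt g (lateral a) := by
  refine ⟨⟨fun x => 1 - ((x : ℂ × ℝ).2 : ℂ), by fun_prop⟩,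
    mem_sliceHolomorphic_of_height (fun t => 1 - (t : ℂ)) fun _ => rfl, fun _ => rfl,
    fun x hx => ?_⟩
  have h0 : 0 < (x : ℂ × ℝ).2 := by
    refine (height_nonneg x).lt_of_ne fun h => hx (Subtype.ext (Prod.ext ?_ ?_))
    · exact (norm_le_zero_iff.mp (h ▸ x.2.1)).trans ha.symm
    · change (x : ℂ × ℝ).2 = ‖(a : ℂ)‖
      rw [ha, norm_zero, h]
  change ‖1 - ((x : ℂ × ℝ).2 : ℂ)‖ < ‖(1 : ℂ) - ((‖(a : ℂ)‖ : ℝ) : ℂ)‖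
  rw [ha, norm_zero, Complex.ofReal_zero, sub_zero, norm_one,
    show (1 : ℂ) - ((x : ℂ × ℝ).2 : ℂ) = ((1 - (x : ℂ × ℝ).2 : ℝ) : ℂ) by push_cast; rfl,
    Complex.norm_real, Real.norm_of_nonneg (by linarith [x.2.2])]
  linarith

theorem exists_inv_peak {a : ClosedDisk} (ha : (a : ℂ) = 0) :
    ∃ f ∈ coneAlgebra, (∀ z : ClosedDisk, f z = 1 / (1 + (‖(z : ℂ)‖ : ℂ))) ∧
      f a = 1 ∧ PeaksAt f a := by
  have hpos : ∀ x : solidCone, 1 + ((x : ℂ × ℝ).2 : ℂ) ≠ 0 := fun x => by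
    have : 1 + (x : ℂ × ℝ).2 ≠ 0 := by linarith [height_nonneg x]
    exact_mod_cast this
  let g : C(solidCone, ℂ) := ⟨fun x => 1 / (1 + ((x : ℂ × ℝ).2 : ℂ)), by
    fun_prop (disch := assumption)⟩
  have hg : g ∈ sliceHolomorphic :=
    mem_sliceHolomorphic_of_height (fun t => 1 / (1 + (t : ℂ))) fun _ => rfl
  have happ : ∀ z : ClosedDisk, g.comp lateral z = 1 / (1 + (‖(z : ℂ)‖ : ℂ)) := fun _ => rfl
  have ha1 : g.comp lateral a = 1 := by rw [happ, ha]; simp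
  refine ⟨g.comp lateral, mem_coneAlgebra_iff.mpr ⟨g, hg, rfl⟩, happ, ha1, fun z hz => ?_⟩
  have hz0 : 0 < ‖(z : ℂ)‖ := norm_pos_iff.mpr fun h => hz (Subtype.ext (h.trans ha.symm))
  rw [ha1, happ, norm_one,
    show (1 : ℂ) / (1 + (‖(z : ℂ)‖ : ℂ)) = ((1 / (1 + ‖(z : ℂ)‖) : ℝ) : ℂ) by push_cast; rfl,
    Complex.norm_real, Real.norm_of_nonneg (by positivity), div_lt_one (by positivity)]
  linarith

/-- Peaking over all of `K` serves both boundaries: directly for the Shilov boundary, and by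
restriction to the lateral surface for the Bear–Shilov one. -/
theorem exists_peak (a : ClosedDisk) : ∃ g ∈ sliceHolomorphic, PeaksAt g (lateral a) := by
  by_cases ha : (a : ℂ) = 0
  · obtain ⟨g, hg, -, h⟩ := exists_one_sub_peak ha
    exact ⟨g, hg, h⟩
  · obtain ⟨g, hg, -, h⟩ := exists_exp_peak ha
    exact ⟨g, hg, h⟩

/-! ### Closed boundaries contain all peak points -/

theorem IsClosedBoundary.mem_of_peaksAt {X : Type*} [TopologicalSpace X] {L : Set C(X, ℂ)}
    {E : Set X} (hE : IsClosedBoundary L E) {f : C(X, ℂ)} (hf : f ∈ L) {a : X}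
    (ha : PeaksAt f a) : a ∈ E := by
  obtain ⟨y, hy, hmax⟩ := hE.2 f hf
  by_contra hne
  exact (ha y fun h => hne (h ▸ hy)).not_ge (hmax a)

theorem exists_forall_norm_le (f : C(ClosedDisk, ℂ)) : ∃ z₀, ∀ z, ‖f z‖ ≤ ‖f z₀‖ := by
  have : Nonempty ClosedDisk := ⟨⟨0, by simp⟩⟩
  obtain ⟨z₀, -, hz₀⟩ := isCompact_univ.exists_isMaxOn Set.univ_nonempty
    f.continuous.norm.continuousOn
  exact ⟨z₀, fun z => hz₀ (Set.mem_univ z)⟩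

theorem isBearShilovBoundary_univ :
    IsBearShilovBoundary (coneAlgebra : Set C(ClosedDisk, ℂ)) Set.univ := by
  refine ⟨⟨isClosed_univ, fun f _ => ?_⟩, fun E hE a _ => ?_⟩
  · obtain ⟨z₀, h⟩ := exists_forall_norm_le f
    exact ⟨z₀, trivial, h⟩
  · obtain ⟨g, hg, hpeak⟩ := exists_peak a
    exact hE.mem_of_peaksAt (mem_coneAlgebra_iff.mpr ⟨g, hg, rfl⟩) hpeak.comp_lateral

theorem setOf_mem_coneSurface :
    {x : solidCone | (x : ℂ × ℝ) ∈ coneSurface} = Set.range lateral := by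
  ext x
  constructor
  · rintro ⟨-, -, h⟩
    exact ⟨_, lateral_of_norm_eq h⟩
  · rintro ⟨z, rfl⟩
    exact ⟨norm_nonneg _, mem_closedBall_zero_iff.mp z.2, rfl⟩

theorem isShilovBoundary_coneSurface :
    IsShilovBoundary coneAlgebra (coneHomeo '' {x | (x : ℂ × ℝ) ∈ coneSurface}) := by
  rw [setOf_mem_coneSurface]
  refine ⟨⟨coneHomeo.isClosedMap _ (isCompact_range lateral.continuous).isClosed, ?_⟩, ?_⟩
  · rintro _ ⟨f, rfl⟩
    obtain ⟨z₀, h⟩ := exists_forall_norm_le (f : C(ClosedDisk, ℂ))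
    refine ⟨_, ⟨_, ⟨z₀, rfl⟩, rfl⟩, fun φ => ?_⟩
    obtain ⟨x, rfl⟩ := coneHomeo.surjective φ
    change ‖coneExtension f x‖ ≤ ‖coneExtension f (lateral z₀)‖
    refine norm_le_of_forall_lateral (coneExtension_mem f) x fun y _ hy => ?_
    rw [← lateral_of_norm_eq hy, coneExtension_lateral, coneExtension_lateral]
    exact h _
  · rintro E hE _ ⟨_, ⟨a, rfl⟩, rfl⟩
    obtain ⟨g, hg, hpeak⟩ := exists_peak a
    refine hE.mem_of_peaksAt ⟨lateralEquiv ⟨g, mem_polyCone_iff.mpr hg⟩, rfl⟩ fun φ hφ => ?_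
    obtain ⟨x, rfl⟩ := coneHomeo.surjective φ
    rw [gelfandTransform_apply_apply, gelfandTransform_apply_apply, coneHomeo_apply,
      coneHomeo_apply, coneExtension_lateralEquiv]
    exact hpeak x fun h => hφ (h ▸ rfl)

/-! ### Radial peak functions -/

theorem exists_isRadialPeak {ρ : ℝ} (hρ : 0 < ρ) : ∃ p : ℝ → ℝ, IsRadialPeak p ρ := by
  -- `x * exp (-x/ρ)` is maximal at `ρ`; it is normalized by its maximum.
  refine ⟨fun x => x * Real.exp (-(x / ρ)) / (ρ * Real.exp (-1)), by fun_prop,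
    ⟨(ρ * Real.exp (-1))⁻¹, fun x hx => ?_⟩, ?_, fun x hx hne => ⟨?_, ?_⟩⟩
  · change x * Real.exp (-(x / ρ)) / (ρ * Real.exp (-1)) ≤ _
    rw [div_eq_inv_mul]
    refine mul_le_mul_of_nonneg_left ?_ (by positivity)
    refine mul_le_of_le_one_right hx.1 (Real.exp_le_one_iff.mpr ?_)
    have := div_nonneg hx.1 hρ.le
    linarith
  · simp only [div_self hρ.ne']
    exact div_self (by positivity)
  · have := hx.1
    positivity
  · rw [div_lt_one (by positivity)]
    exact mul_exp_neg_div_lt hρ hne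

theorem IsRadialPeak.nonneg {p : ℝ → ℝ} {ρ : ℝ} (hp : IsRadialPeak p ρ) {x : ℝ}
    (hx : x ∈ Set.Icc (0 : ℝ) 1) : 0 ≤ p x := by
  by_cases h : x = ρ
  · rw [h, hp.2.2.1]; exact zero_le_one
  · exact (hp.2.2.2 x hx h).1

theorem IsRadialPeak.map_zero {p : ℝ → ℝ} {ρ : ℝ} (hp : IsRadialPeak p ρ) : p 0 = 0 := by
  have h0 : (0 : ℝ) ∈ Set.Icc (0 : ℝ) 1 := by simp
  obtain ⟨C, hC⟩ := hp.2.1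
  exact le_antisymm (by simpa using hC 0 h0) (hp.nonneg h0)

theorem IsRadialPeak.continuous_height {p : ℝ → ℝ} {ρ : ℝ} (hp : IsRadialPeak p ρ) :
    Continuous fun x : solidCone => p (x : ℂ × ℝ).2 :=
  hp.1.comp_continuous (by fun_prop) fun x => ⟨height_nonneg x, x.2.2⟩

/-- Only height `0` is delicate: there `|z| ≤ t` bounds the function by `p t`, which tends to `p 0 =
0`. -/
theorem IsRadialPeak.continuous_mul_div {p : ℝ → ℝ} {ρ : ℝ} (hp : IsRadialPeak p ρ) :
    Continuous fun x : solidCone => (x : ℂ × ℝ).1 * ((p (x : ℂ × ℝ).2 : ℂ) / (x : ℂ × ℝ).2) := by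
  have hcont := hp.continuous_height
  rw [continuous_iff_continuousAt]
  intro x
  by_cases hx : (x : ℂ × ℝ).2 = 0
  · have hb : ∀ y : solidCone,
        ‖(y : ℂ × ℝ).1 * ((p (y : ℂ × ℝ).2 : ℂ) / (y : ℂ × ℝ).2)‖ ≤ p (y : ℂ × ℝ).2 := fun y => by
      have hp0 := hp.nonneg ⟨height_nonneg y, y.2.2⟩
      rw [norm_mul, norm_div, Complex.norm_real, Complex.norm_real, Real.norm_of_nonneg hp0,
        Real.norm_of_nonneg (height_nonneg y), mul_div_left_comm]
      exact mul_le_of_le_one_right hp0 (div_le_one_of_le₀ y.2.1 (height_nonneg y))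
    have h0 : (x : ℂ × ℝ).1 * ((p (x : ℂ × ℝ).2 : ℂ) / (x : ℂ × ℝ).2) = 0 := by simp [hx]
    rw [ContinuousAt, h0]
    refine squeeze_zero_norm hb ?_
    have := hcont.tendsto x
    rwa [hx, hp.map_zero] at this
  · have hxC : ((x : ℂ × ℝ).2 : ℂ) ≠ 0 := by exact_mod_cast hx
    have h1 : Continuous fun x : solidCone => (p (x : ℂ × ℝ).2 : ℂ) :=
      Complex.continuous_ofReal.comp hcont
    have h2 : Continuous fun x : solidCone => ((x : ℂ × ℝ).2 : ℂ) := by fun_prop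
    exact (continuous_fst.comp continuous_subtype_val).continuousAt.mul
      (h1.continuousAt.div h2.continuousAt hxC)

theorem norm_peakFormula_lt {p : ℝ → ℝ} {a z : ℂ} (hz : z ≠ a) (hz1 : ‖z‖ ≤ 1)
    (hp : IsRadialPeak p ‖a‖) : ‖peakFormula p a z‖ < 1 := by
  rw [peakFormula]
  split_ifs with h0
  · simp
  · have hz0 := norm_pos_iff.mpr h0
    have hzC : (‖z‖ : ℂ) ≠ 0 := by exact_mod_cast hz0.ne'
    have hmem : ‖z‖ ∈ Set.Icc (0 : ℝ) 1 := ⟨norm_nonneg z, hz1⟩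
    have hp0 := hp.nonneg hmem
    set u := z / (‖z‖ : ℂ) * Complex.exp (-(Complex.arg a : ℂ) * Complex.I) with hu
    have hu1 : ‖u‖ = 1 := by
      rw [hu, ← Complex.ofReal_neg, norm_mul, Complex.norm_exp_ofReal_mul_I, norm_div,
        Complex.norm_real, norm_norm, div_self hz0.ne', mul_one]
    have hle : ‖1 + u‖ ≤ 2 := (norm_add_le _ _).trans (by rw [hu1, norm_one]; norm_num)
    have hn : ‖(1 + u) * ((p ‖z‖ : ℝ) / 2 : ℂ)‖ = ‖1 + u‖ * (p ‖z‖ / 2) := by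
      rw [norm_mul, norm_div, Complex.norm_real, Real.norm_of_nonneg hp0]
      simp
    rw [hn]
    by_cases hza : ‖z‖ = ‖a‖
    · rw [hza, hp.2.2.1]
      -- `u` compares the arguments of `z` and `a`; with equal moduli, `u = 1` would force `z = a`.
      have hune : u ≠ 1 := fun h => hz <| by
        have h1 := Complex.norm_mul_exp_arg_mul_I a
        have h2 : Complex.exp (-(Complex.arg a : ℂ) * Complex.I) *
            Complex.exp ((Complex.arg a : ℂ) * Complex.I) = 1 := by
          rw [← Complex.exp_add]; simp
        rw [hu] at h
        rw [← h1, ← hza]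
        rw [div_mul_eq_mul_div, div_eq_iff hzC, one_mul] at h
        calc z = z * (Complex.exp (-(Complex.arg a : ℂ) * Complex.I) *
            Complex.exp ((Complex.arg a : ℂ) * Complex.I)) := by rw [h2, mul_one]
          _ = _ := by rw [← mul_assoc, h]
      have := norm_add_mul_lt (a := 1) one_pos (by rw [hu1, norm_one]) hune
      rw [Complex.ofReal_one, mul_one, norm_one] at this
      linarith
    · have := (hp.2.2.2 _ hmem hza).2
      nlinarith

theorem exists_peakFormula {p : ℝ → ℝ} {a : ClosedDisk} (ha : (a : ℂ) ≠ 0)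
    (hp : IsRadialPeak p ‖(a : ℂ)‖) : ∃ f ∈ coneAlgebra,
      (∀ z : ClosedDisk, f z = peakFormula p a z) ∧ f a = 1 ∧ PeaksAt f a := by
  set e := Complex.exp (-(Complex.arg a : ℂ) * Complex.I) with he
  have hcont1 : Continuous fun x : solidCone => (p (x : ℂ × ℝ).2 : ℂ) :=
    Complex.continuous_ofReal.comp hp.continuous_height
  have hcont2 := hp.continuous_mul_div
  -- The formula with `|z|` replaced by `t` is affine in `z` on every slice, hence
  -- slice-holomorphic.
  let g : C(solidCone, ℂ) := ⟨fun x => ((p (x : ℂ × ℝ).2 : ℂ) +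
    (x : ℂ × ℝ).1 * ((p (x : ℂ × ℝ).2 : ℂ) / (x : ℂ × ℝ).2) * e) / 2, by fun_prop⟩
  have hg : g ∈ sliceHolomorphic := mem_sliceHolomorphic_iff.mpr fun t _ _ =>
    ⟨fun z => ((p t : ℂ) + z * ((p t : ℂ) / t) * e) / 2, Differentiable.diffContOnCl (by fun_prop),
      fun x hx => by subst hx; rfl⟩
  have happ : ∀ z : ClosedDisk, g.comp lateral z = peakFormula p a z := fun z => by
    change ((p ‖(z : ℂ)‖ : ℂ) + (z : ℂ) * ((p ‖(z : ℂ)‖ : ℂ) / (‖(z : ℂ)‖ : ℝ)) * e) / 2 = _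
    rw [peakFormula]
    split_ifs with h0
    · simp [h0, hp.map_zero]
    · rw [← he]; ring
  have ha1 : g.comp lateral a = 1 := by
    have h1 := Complex.norm_mul_exp_arg_mul_I (a : ℂ)
    have haC : (‖(a : ℂ)‖ : ℂ) ≠ 0 := by exact_mod_cast norm_ne_zero_iff.mpr ha
    have h2 : Complex.exp ((Complex.arg a : ℂ) * Complex.I) * e = 1 := by
      rw [he, ← Complex.exp_add]; simp
    have h3 : (a : ℂ) / (‖(a : ℂ)‖ : ℂ) = Complex.exp ((Complex.arg a : ℂ) * Complex.I) := by
      rw [div_eq_iff haC, mul_comm, h1]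
    rw [happ, peakFormula, if_neg ha, ← he, h3, h2, hp.2.2.1]
    norm_num
  refine ⟨g.comp lateral, mem_coneAlgebra_iff.mpr ⟨g, hg, rfl⟩, happ, ha1, fun z hz => ?_⟩
  rw [ha1, norm_one, happ]
  exact norm_peakFormula_lt (fun h => hz (Subtype.ext h)) (mem_closedBall_zero_iff.mp z.2) hp

theorem theorem1 :
    -- (1)
    diskAlgebra 1 ⊆ (coneAlgebra : Set C(ClosedDisk, ℂ)) ∧
    -- (2)
    (restrictToCircle (coneAlgebra : Set C(ClosedDisk, ℂ)) le_rfl =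
        restrictToCircle (diskAlgebra 1) le_rfl ∧
      restrictToCircle (diskAlgebra 1) le_rfl =
        polyClosure (Metric.sphere (0 : ℂ) 1)) ∧
    -- (3)
    (∀ (r : ℝ) (_ : 0 < r) (h₁ : r < 1),
      restrictToCircle (coneAlgebra : Set C(ClosedDisk, ℂ)) h₁.le =
        polyClosure (Metric.sphere (0 : ℂ) r)) ∧
    -- (4), the cone in `ℝ³`
    (Nonempty (ConeSpectrum ≃ₜ solidCone₃) ∧ dimH solidCone₃ = 3) ∧
    -- (5), the list of all characters
    (Set.range (fun (φ : ConeSpectrum) (f : coneAlgebra) => φ f) =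
        {fun f : coneAlgebra => diskEval f 0} ∪
          {ψ | ∃ (r : ℝ) (a : ℂ), 0 < r ∧ r ≤ 1 ∧ ‖a‖ ≤ r ∧
            ψ = fun f : coneAlgebra => coneFunctional r a f} ∧
      ∀ (r : ℝ) (a : ℂ), 0 < r → r ≤ 1 → ‖a‖ < r → ∀ f : coneAlgebra,
        poissonIntegral 1 (fun z => diskEval f (r * z)) (a / r) =
          poissonIntegral r (diskEval f) a) ∧
    -- (4), (5), (6), (8) through the homeomorphism `(a, r) ↦ ψ_{r,a}` from the cone in `ℂ × ℝ`
    (∃ Φ : solidCone ≃ₜ ConeSpectrum,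
      (∀ (x : solidCone) (f : coneAlgebra),
        Φ x f = coneFunctional (x : ℂ × ℝ).2 (x : ℂ × ℝ).1 f) ∧
      gelfandOnCone Φ = closure conePolynomials ∧
      gelfandOnCone Φ = sliceHolomorphic ∧
      IsShilovBoundary coneAlgebra (Φ '' {x | (x : ℂ × ℝ) ∈ coneSurface})) ∧
    coneSurface = frontier solidCone \ {p : ℂ × ℝ | ‖p.1‖ < 1 ∧ p.2 = 1} ∧
    -- (7)
    (IsInverseClosed coneAlgebra ∧ CoronaCondition coneAlgebra 1 ∧
      ∀ n : ℕ, 2 ≤ n → ¬ CoronaCondition coneAlgebra n) ∧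
    -- (8), the Bear--Shilov boundary on the disk
    IsBearShilovBoundary (coneAlgebra : Set C(ClosedDisk, ℂ)) Set.univ ∧
    -- (8), explicit peak functions at `0`
    (∀ a : ClosedDisk, (a : ℂ) = 0 →
      (∃ f ∈ coneAlgebra, (∀ z : ClosedDisk, f z = 1 / (1 + (‖(z : ℂ)‖ : ℂ))) ∧
        f a = 1 ∧ PeaksAt f a) ∧
      (∃ f ∈ coneAlgebra, (∀ z : ClosedDisk, f z = 1 - (‖(z : ℂ)‖ : ℂ)) ∧
        f a = 1 ∧ PeaksAt f a)) ∧
    -- (8), explicit peak functions at the other points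
    (∀ a : ClosedDisk, (a : ℂ) ≠ 0 →
      (∃ p : ℝ → ℝ, IsRadialPeak p ‖(a : ℂ)‖) ∧
      (∀ p : ℝ → ℝ, IsRadialPeak p ‖(a : ℂ)‖ →
        ∃ f ∈ coneAlgebra, (∀ z : ClosedDisk, f z = peakFormula p a z) ∧
          f a = 1 ∧ PeaksAt f a) ∧
      (∃ f ∈ coneAlgebra,
        (∀ z : ClosedDisk, f z = (a : ℂ) + z * (Real.exp (-(‖(z : ℂ)‖ / ‖(a : ℂ)‖)) : ℂ)) ∧
        PeaksAt f a)) := by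
  refine ⟨diskAlgebra_subset_coneAlgebra,
    ⟨(restrictToCircle_coneAlgebra one_pos le_rfl).trans restrictToCircle_diskAlgebra.symm,
      restrictToCircle_diskAlgebra⟩,
    fun r hr h₁ => restrictToCircle_coneAlgebra hr h₁.le,
    ⟨⟨coneHomeo.symm.trans solidConeHomeo⟩, dimH_solidCone₃⟩,
    ⟨range_characters, fun r a hr _ _ f => poissonIntegral_one_div hr _ a⟩,
    ⟨coneHomeo, fun x f => (coneFunctional_eq_coneExtension x f).symm,
      range_coneExtension.trans closure_conePolynomials.symm,
      range_coneExtension.trans polyCone_eq_sliceHolomorphic, isShilovBoundary_coneSurface⟩,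
    coneSurface_eq_frontier_diff,
    ⟨isInverseClosed_coneAlgebra, coronaCondition_one, fun n hn => not_coronaCondition hn⟩,
    isBearShilovBoundary_univ, fun a ha => ⟨exists_inv_peak ha, ?_⟩,
    fun a ha => ⟨exists_isRadialPeak (norm_pos_iff.mpr ha), fun p hp => exists_peakFormula ha hp,
      ?_⟩⟩
  · obtain ⟨g, hg, happ, hpeak⟩ := exists_one_sub_peak ha
    refine ⟨g.comp lateral, mem_coneAlgebra_iff.mpr ⟨g, hg, rfl⟩, fun z => happ (lateral z), ?_,
      hpeak.comp_lateral⟩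
    rw [ContinuousMap.comp_apply, happ]
    simp [lateral, ha]
  · obtain ⟨g, hg, happ, hpeak⟩ := exists_exp_peak ha
    exact ⟨g.comp lateral, mem_coneAlgebra_iff.mpr ⟨g, hg, rfl⟩, fun z => happ (lateral z),
      hpeak.comp_lateral⟩
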